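/- Let $X=\begin{pmatrix}0&1\\1&0\end{pmatrix}$, $Z=\begin{pmatrix}1&0\\0&-1\end{pmatrix}$, let $\theta_A,\theta_B\in[0,\pi]$, and consider the two-qubit observables $$A_1=X\otimes X,\qquad A_2=(\cos\theta_A X+\sin\theta_A Z)\otimes(\cos\theta_B X+\sin\theta_B Z).$$ Let $L=\{(\operatorname{Tr}\rho A_1,\operatorname{Tr}\rho A_2)\in\mathbb R^2\}$, where $\rho$ runs over all two-qubit states (positive semidefinite matrices of trace one), and let $L_{\mathrm{SEP}}$ be the same set with $\rho$ running only over the separable states (convex combinations of product states $\sigma\otimes\tau$). Write $\operatorname{vol}$ for the Euclidean area, $\theta_\pm=\theta_A\pm\theta_B$, and let $\mathcal E(a,b)\subset\mathbb R^2$ be the filled (possibly degenerate) ellipse centred at the origin with semi-axis $a$ along $(1,1)/\sqrt2$ and semi-axis $b$ along $(-1,1)/\sqrt2$. Put $$T(x,y)=\left|\frac{\tan\frac x2}{\tan\frac y2}\right|,\qquad F(x,y)=\left|\sin\tfrac x2\cos\tfrac y2\right|\left[K\bigl(1-T(x,y)^2\bigr)-E\bigl(1-T(x,y)^2\bigr)\right],$$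 where $K(m)=\int_0^{\pi/2}\frac{dt}{\sqrt{1-m\sin^2t}}$ and $E(m)=\int_0^{\pi/2}\sqrt{1-m\sin^2t}\,dt$ are the complete elliptic integrals, and $$\tilde F(x,y)=F(x,y)-F(y,x),\qquad \tilde T(x,y)=T(x,y)-T(y,x),$$ $$G_-(x)=\left|\tfrac x2\sin x\right|,\qquad G_+(y)=\left|\left(\tfrac y2-\tfrac\pi2\right)\sin y\right|.$$ Then the following hold. 1. $L_{\mathrm{SEP}}$ is the Minkowski sum of two ellipses, $$L_{\mathrm{SEP}}=\mathcal E\left(\tfrac{|\cos(\theta_- /2)|}{\sqrt2},\tfrac{|\sin(\theta_- /2)|}{\sqrt2}\right)+\mathcal E\left(\tfrac{|\cos(\theta_+/2)|}{\sqrt2},\tfrac{|\sin(\theta_+/2)|}{\sqrt2}\right),$$ and $L$ is the convex hull of two other ellipses, $$L=\operatorname{conv}\left(\mathcal E\bigl(\sqrt{1+\cos\theta_-},\sqrt{1-\cos\theta_-}\bigr)\cup\mathcal E\bigl(\sqrt{1+\cos\theta_+},\sqrt{1-\cos\theta_+}\bigr)\right).$$ Both sets have finite area. 2. $\operatorname{vol}L=2\left[\cos\theta_--\cos\theta_++G_-(\theta_-)+G_+(\theta_+)\right]$.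 3. If $0<\theta_A,\theta_B<\pi$, $\theta_A\ne\theta_B$ and $\theta_A+\theta_B\neq\pi$ (these are exactly the parameters for which the right-hand sides below are defined), then $$\operatorname{vol}L_{\mathrm{SEP}}=\frac\pi4\bigl(|\sin\theta_-|+|\sin\theta_+|\bigr)+\frac{2\left[F(\theta_-,\theta_+)-F(\theta_+,\theta_-)\right]}{T(\theta_+,\theta_-)-T(\theta_-,\theta_+)}$$ and $$\frac{\operatorname{vol}L_{\mathrm{SEP}}}{\operatorname{vol}L}=\frac{\frac\pi8\bigl(|\sin\theta_-|+|\sin\theta_+|\bigr)-\dfrac{\tilde F(\theta_-,\theta_+)}{\tilde T(\theta_-,\theta_+)}}{\cos\theta_--\cos\theta_++G_-(\theta_-)+G_+(\theta_+)}.$$ 4. At every $(\theta_A,\theta_B)\in[0,\pi]^2$, $\operatorname{vol}L_{\mathrm{SEP}}$ is the limit of the first right-hand side in 3 along parameters as in 3 that tend to $(\theta_A,\theta_B)$. If $\sin\theta_A$ and $\sin\theta_B$ are not both zero, then $\operatorname{vol}L>0$, and $\operatorname{vol}L_{\mathrm{SEP}}/\operatorname{vol}L$ is the limit of the second right-hand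 side in the same sense. -/

import Mathlib

open scoped Kronecker Pointwise ComplexOrder

noncomputable section

namespace TwoQubit

/-- Quantum states (density matrices): positive semidefinite matrices of trace one. -/
def states (n : Type*) [Fintype n] : Set (Matrix n n ℂ) :=
  {ρ | ρ.PosSemidef ∧ ρ.trace = 1}

/-- Separable states of a bipartite system: convex combinations of product states. -/
def sepStates (m n : Type*) [Fintype m] [Fintype n] : Set (Matrix (m × n) (m × n) ℂ) :=
  convexHull ℝ {ρ | ∃ σ ∈ states m, ∃ τ ∈ states n, ρ = σ ⊗ₖ τ}

/-- The joint numerical range of `A 0, …, A (k - 1)` restricted to the states in `S`. -/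
def numRange {n : Type*} [Fintype n] {k : ℕ} (S : Set (Matrix n n ℂ))
    (A : Fin k → Matrix n n ℂ) : Set (EuclideanSpace ℝ (Fin k)) :=
  {p | ∃ ρ ∈ S, ∀ j, ((p j : ℝ) : ℂ) = (ρ * A j).trace}

/-- The Euclidean volume. -/
def vol {k : ℕ} (S : Set (EuclideanSpace ℝ (Fin k))) : ℝ :=
  (MeasureTheory.volume S).toReal

def pauliX : Matrix (Fin 2) (Fin 2) ℂ := !![0, 1; 1, 0]

def pauliZ : Matrix (Fin 2) (Fin 2) ℂ := !![1, 0; 0, -1]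

/-- The qubit observable `cos θ X + sin θ Z`. -/
def pauliXZ (θ : ℝ) : Matrix (Fin 2) (Fin 2) ℂ :=
  (Real.cos θ : ℂ) • pauliX + (Real.sin θ : ℂ) • pauliZ

/-- The pair of locally traceless product observables in standard form. -/
def obs (θA θB : ℝ) : Fin 2 → Matrix (Fin 2 × Fin 2) (Fin 2 × Fin 2) ℂ :=
  ![pauliX ⊗ₖ pauliX, pauliXZ θA ⊗ₖ pauliXZ θB]

/-- The numerical range of the pair. -/
def L (θA θB : ℝ) : Set (EuclideanSpace ℝ (Fin 2)) :=
  numRange (states (Fin 2 × Fin 2)) (obs θA θB)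

/-- The separable numerical range of the pair. -/
def LSEP (θA θB : ℝ) : Set (EuclideanSpace ℝ (Fin 2)) :=
  numRange (sepStates (Fin 2) (Fin 2)) (obs θA θB)

/-- The (filled) ellipse centred at the origin with semi-axis `a` along the diagonal direction
`(1, 1) / √2` and semi-axis `b` along the direction `(-1, 1) / √2`; it is a line segment or a
point when a semi-axis vanishes. -/
def ellipse (a b : ℝ) : Set (EuclideanSpace ℝ (Fin 2)) :=
  {p | ∃ u v : ℝ, u ^ 2 + v ^ 2 ≤ 1 ∧
    (p 0 + p 1) / √2 = a * u ∧ (-p 0 + p 1) / √2 = b * v}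

/-- Complete elliptic integral of the first kind, as a function of the parameter `m` (the square
of the modulus), `m < 1`. -/
def ellK (m : ℝ) : ℝ :=
  ∫ t in (0 : ℝ)..(Real.pi / 2), 1 / √(1 - m * Real.sin t ^ 2)

/-- Complete elliptic integral of the second kind, as a function of the parameter `m`. -/
def ellE (m : ℝ) : ℝ :=
  ∫ t in (0 : ℝ)..(Real.pi / 2), √(1 - m * Real.sin t ^ 2)

def T (x y : ℝ) : ℝ := |Real.tan (x / 2) / Real.tan (y / 2)|

def F (x y : ℝ) : ℝ :=
  |Real.sin (x / 2) * Real.cos (y / 2)| * (ellK (1 - T x y ^ 2) - ellE (1 - T x y ^ 2))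

def Ftilde (x y : ℝ) : ℝ := F x y - F y x

def Ttilde (x y : ℝ) : ℝ := T x y - T y x

def Gminus (x : ℝ) : ℝ := |x / 2 * Real.sin x|

def Gplus (y : ℝ) : ℝ := |(y / 2 - Real.pi / 2) * Real.sin y|

/-- The closed form of the area of the separable numerical range, in `x = θ₋` and `y = θ₊`. -/
def sepArea (x y : ℝ) : ℝ :=
  Real.pi / 4 * (|Real.sin x| + |Real.sin y|) + 2 * (F x y - F y x) / (T y x - T x y)

/-- The closed form of the area of the numerical range, in `x = θ₋` and `y = θ₊`. -/
def fullArea (x y : ℝ) : ℝ :=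
  2 * (Real.cos x - Real.cos y + |x / 2 * Real.sin x|
    + |(y / 2 - Real.pi / 2) * Real.sin y|)

/-- The closed form of the volume ratio, in `x = θ₋` and `y = θ₊`. -/
def ratio (x y : ℝ) : ℝ :=
  (Real.pi / 8 * (|Real.sin x| + |Real.sin y|) - Ftilde x y / Ttilde x y) /
    (Real.cos x - Real.cos y + Gminus x + Gplus y)

/-- The parameters in `[0, π] × [0, π]` for which all quotients and tangents in `sepArea` and
`ratio` are defined without division by zero. -/
def regular : Set (ℝ × ℝ) :=
  {t | t.1 ∈ Set.Ioo 0 Real.pi ∧ t.2 ∈ Set.Ioo 0 Real.pi ∧ t.1 ≠ t.2 ∧ t.1 + t.2 ≠ Real.pi}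

end TwoQubit

end

noncomputable section

open Real Set MeasureTheory

namespace TwoQubit

/-! Separable range. Only the $XZ$-components of the Bloch vectors matter; read them as complex
numbers $v,v'$ in the unit disc. Product-to-sum formulas turn the expectations of
$\sigma\otimes\tau$ into half the sum of a point depending on $v\bar v'$ and $\theta_-$ and a point
depending on $vv'$ and $\theta_+$. Each runs in the linear image of a disc, an ellipse. Conversely,
on the unit circles the arguments of $v\bar v'$ and $vv'$ can be prescribed independently, so the
convex hull fills the Minkowski sum (`LSEP_eq`).

Full range. Both observables commute with $Y\otimes Y$, whose two eigenspaces are planes spanned by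
real vectors. On each plane the pair acts like two observables of one qubit and contributes one
ellipse; a state weights the two planes, which gives the convex hull (`L_eq`).

Areas. For the sum, the points of the two boundaries with a common normal are added. Integration
gives the two ellipse areas plus a mixed term, the integral of one support function along the other
boundary (`volume_planarEllipse_add_of_pos`); degenerate ellipses follow by continuity from above.
For the hull, both ellipses have squared semi-axes summing to $2$, hence touch the same square
$|x|+|y|\le\sqrt2$; the hull is bounded by elliptic arcs and pieces of the sides of that square
(`volume_hull_inscribed`).

Closed form. The mixed term is a single complete integral $E(1-k^2)$ with $k=T(\theta_-,\theta_+)$.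
Exchanging the arguments inverts $k$, and the reciprocal-modulus transformation of $K$ and $E$
cancels $K$ from $F(x,y)-F(y,x)$ (`vol_LSEP_of_regular`). -/

/-! ### Ellipses in their own axes, and areas from vertical slices -/

/-- The filled ellipse with semi-axes `a` and `b` along the coordinate axes. -/
def planarEllipse (a b : ℝ) : Set (ℝ × ℝ) :=
  {q | ∃ u v : ℝ, u ^ 2 + v ^ 2 ≤ 1 ∧ q.1 = a * u ∧ q.2 = b * v}

/-- The rotation of the plane taking `(1, 1) / √2` and `(-1, 1) / √2` to the coordinate axes. -/
def rot : EuclideanSpace ℝ (Fin 2) ≃ₗ[ℝ] ℝ × ℝ where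
  toFun p := ((p 0 + p 1) / √2, (-p 0 + p 1) / √2)
  invFun q := !₂[(q.1 - q.2) / √2, (q.1 + q.2) / √2]
  map_add' p q := by ext <;> simp <;> ring
  map_smul' c p := by ext <;> simp <;> ring
  left_inv p := by
    have h2 : √2 ^ 2 = 2 := by norm_num
    have h0 : √2 ≠ 0 := by positivity
    ext i; fin_cases i <;> simp <;> field_simp <;> rw [h2] <;> ring
  right_inv q := by
    have h2 : √2 ^ 2 = 2 := by norm_num
    have h0 : √2 ≠ 0 := by positivity
    ext <;> simp <;> field_simp <;> rw [h2] <;> ring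

theorem rot_apply (p : EuclideanSpace ℝ (Fin 2)) :
    rot p = ((p 0 + p 1) / √2, (-p 0 + p 1) / √2) := rfl

theorem ellipse_eq_preimage (a b : ℝ) : ellipse a b = rot ⁻¹' planarEllipse a b := rfl

theorem ellipse_eq_image (a b : ℝ) : ellipse a b = rot.symm '' planarEllipse a b := by
  rw [ellipse_eq_preimage, LinearEquiv.image_symm_eq_preimage]

theorem volume_rot_symm_image {Q : Set (ℝ × ℝ)} (hQ : MeasurableSet Q) :
    volume (rot.symm '' Q) = volume Q := by
  let M : Matrix (Fin 2) (Fin 2) ℝ := !![1 / √2, 1 / √2; -1 / √2, 1 / √2]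
  have hdet : LinearMap.det (Matrix.toLin' M) = 1 := by
    rw [LinearMap.det_toLin', Matrix.det_fin_two_of]
    have h2 : √2 * √2 = 2 := by norm_num
    have h0 : √2 ≠ 0 := by positivity
    field_simp
    nlinarith
  have hset : rot.symm '' Q = (WithLp.ofLp : EuclideanSpace ℝ (Fin 2) → (Fin 2 → ℝ)) ⁻¹'
      ((Matrix.toLin' M) ⁻¹' (MeasurableEquiv.finTwoArrow ⁻¹' Q)) := by
    rw [LinearEquiv.image_symm_eq_preimage]
    ext p
    have : MeasurableEquiv.finTwoArrow (Matrix.toLin' M p.ofLp) = rot p := by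
      rw [rot_apply]
      simp [M, MeasurableEquiv.finTwoArrow, dotProduct, Fin.sum_univ_two]
      constructor <;> ring
    simp only [mem_preimage, this]
  have hm : MeasurableSet ((MeasurableEquiv.finTwoArrow : (Fin 2 → ℝ) ≃ᵐ ℝ × ℝ) ⁻¹' Q) :=
    MeasurableEquiv.finTwoArrow.measurable hQ
  have hm' : MeasurableSet ((Matrix.toLin' M) ⁻¹'
      ((MeasurableEquiv.finTwoArrow : (Fin 2 → ℝ) ≃ᵐ ℝ × ℝ) ⁻¹' Q)) :=
    (LinearMap.continuous_of_finiteDimensional (Matrix.toLin' M)).measurable hm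
  rw [hset, (PiLp.volume_preserving_ofLp (Fin 2)).measure_preimage hm'.nullMeasurableSet,
    Measure.addHaar_preimage_linearMap volume (by rw [hdet]; exact one_ne_zero),
    (volume_preserving_finTwoArrow ℝ).measure_preimage hQ.nullMeasurableSet, hdet]
  simp

/-- The area of a set that is symmetric about the vertical axis, from its vertical slices. -/
theorem volume_eq_two_mul_lintegral_slice {Q : Set (ℝ × ℝ)} (hQ : MeasurableSet Q) {R : ℝ}
    (hsymm : ∀ x y, (x, y) ∈ Q → (-x, y) ∈ Q) (hR : ∀ q ∈ Q, q.1 ≤ R) :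
    volume Q = 2 * ∫⁻ x in Ioo 0 R, volume (Prod.mk x ⁻¹' Q) := by
  set f : ℝ → ENNReal := fun x => volume (Prod.mk x ⁻¹' Q) with hf
  have heven : ∀ x, f (-x) = f x := fun x => by
    have : Prod.mk (-x) ⁻¹' Q = Prod.mk x ⁻¹' Q := by
      ext y
      exact ⟨fun h => by simpa using hsymm _ _ h, fun h => hsymm _ _ h⟩
    simp only [hf, this]
  have h1 : volume Q = ∫⁻ x, f x := by
    rw [Measure.volume_eq_prod, Measure.prod_apply hQ]
  have h2 : ∫⁻ x, f x = (∫⁻ x in Ioi 0, f x) + ∫⁻ x in Iic 0, f x := by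
    rw [← compl_Ioi, lintegral_add_compl _ measurableSet_Ioi]
  have h3 : ∫⁻ x in Iic 0, f x = ∫⁻ x in Ioi 0, f x := by
    rw [restrict_Iio_eq_restrict_Iic.symm]
    have := (Measure.measurePreserving_neg (volume : Measure ℝ)).setLIntegral_comp_preimage_emb
      (MeasurableEquiv.neg ℝ).measurableEmbedding f (Iio 0)
    rw [← this]
    simp only [heven]
    congr 2
    ext x; simp
  have h4 : ∫⁻ x in Ioi 0, f x = ∫⁻ x in Ioo 0 R, f x := by
    have h5 : ∫⁻ x in Ioi 0, f x = ∫⁻ x in Ioc 0 R, f x := by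
      rw [← lintegral_indicator measurableSet_Ioi, ← lintegral_indicator measurableSet_Ioc]
      congr 1
      ext x
      by_cases hx : x ∈ Ioi 0
      swap
      · rw [indicator_of_notMem hx, indicator_of_notMem (fun h => hx h.1)]
      by_cases hx' : x ∈ Ioc 0 R
      · rw [indicator_of_mem hx, indicator_of_mem hx']
      rw [indicator_of_mem hx, indicator_of_notMem hx']
      have : Prod.mk x ⁻¹' Q = ∅ := by
        ext y
        simp only [mem_preimage, mem_empty_iff_false, iff_false]
        exact fun h => hx' ⟨hx, hR _ h⟩
      simp [hf, this]
    rw [h5, restrict_Ioo_eq_restrict_Ioc]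
  rw [h1, h2, h3, h4, two_mul]

/-! ### Calculus of the support function of an ellipse -/

/-- The support function of the ellipse with semi-axes `A`, `B` in the direction
`(cos u, sin u)`. -/
def ellipseSupport (A B u : ℝ) : ℝ := √((A * cos u) ^ 2 + (B * sin u) ^ 2)

theorem continuous_ellipseSupport (A B : ℝ) : Continuous (ellipseSupport A B) := by
  unfold ellipseSupport; fun_prop

theorem ellipseSupport_sq (A B u : ℝ) :
    ellipseSupport A B u ^ 2 = (A * cos u) ^ 2 + (B * sin u) ^ 2 :=
  sq_sqrt (by positivity)

theorem ellipseSupport_pos {A B : ℝ} (hA : 0 < A) (hB : 0 < B) (u : ℝ) :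
    0 < ellipseSupport A B u := by
  apply sqrt_pos.2
  rcases eq_or_ne (sin u) 0 with h | h
  · have : cos u ≠ 0 := fun h' => by
      have := sin_sq_add_cos_sq u
      rw [h, h'] at this
      norm_num at this
    positivity
  · positivity

theorem hasDerivAt_ellipseSupport {A B : ℝ} (hA : 0 < A) (hB : 0 < B) (u : ℝ) :
    HasDerivAt (ellipseSupport A B)
      ((B ^ 2 - A ^ 2) * sin u * cos u / ellipseSupport A B u) u := by
  have hpos := ellipseSupport_pos hA hB u
  have h1 : HasDerivAt (fun u => (A * cos u) ^ 2 + (B * sin u) ^ 2)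
      (2 * (A * cos u) * (A * -sin u) + 2 * (B * sin u) * (B * cos u)) u := by
    exact ((((hasDerivAt_cos u).const_mul A).pow 2).add
      (((hasDerivAt_sin u).const_mul B).pow 2)).congr_deriv (by simp)
  have h2 := h1.sqrt (sqrt_ne_zero'.1 hpos.ne' |>.ne')
  refine h2.congr_deriv ?_
  change _ / (2 * ellipseSupport A B u) = _
  field_simp
  ring

theorem hasDerivAt_cos_div_ellipseSupport {A B : ℝ} (hA : 0 < A) (hB : 0 < B) (u : ℝ) :
    HasDerivAt (fun u => cos u / ellipseSupport A B u)
      (-(B ^ 2 * sin u / ellipseSupport A B u ^ 3)) u := by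
  have hpos := ellipseSupport_pos hA hB u
  refine ((hasDerivAt_cos u).div (hasDerivAt_ellipseSupport hA hB u) hpos.ne').congr_deriv ?_
  have hsq := ellipseSupport_sq A B u
  set D := ellipseSupport A B u
  have hc := sin_sq_add_cos_sq u
  field_simp
  rw [hsq]
  linear_combination (-sin u * B ^ 2) * hc

theorem hasDerivAt_sin_div_ellipseSupport {A B : ℝ} (hA : 0 < A) (hB : 0 < B) (u : ℝ) :
    HasDerivAt (fun u => sin u / ellipseSupport A B u)
      (A ^ 2 * cos u / ellipseSupport A B u ^ 3) u := by
  have hpos := ellipseSupport_pos hA hB u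
  refine ((hasDerivAt_sin u).div (hasDerivAt_ellipseSupport hA hB u) hpos.ne').congr_deriv ?_
  have hsq := ellipseSupport_sq A B u
  set D := ellipseSupport A B u
  have hc := sin_sq_add_cos_sq u
  field_simp
  rw [hsq]
  linear_combination (cos u * A ^ 2) * hc

/-- The derivative of the eccentric angle of a boundary point of an ellipse as a function of the
angle of its normal, a continuous branch of `arctan (B / A * tan u)`. -/
theorem hasDerivAt_eccentricAngle {A B : ℝ} (hA : 0 < A) (hB : 0 < B) (u : ℝ) :
    HasDerivAt
      (fun u => u + arctan ((B - A) * (sin u * cos u) / (A * cos u ^ 2 + B * sin u ^ 2)))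
      (A * B / ellipseSupport A B u ^ 2) u := by
  have hc := sin_sq_add_cos_sq u
  have hden : 0 < A * cos u ^ 2 + B * sin u ^ 2 := by
    rcases eq_or_ne (sin u) 0 with h | h
    · rw [h] at hc ⊢
      nlinarith
    · positivity
  have hsq := ellipseSupport_sq A B u
  have hpos := ellipseSupport_pos hA hB u
  have h1 : HasDerivAt (fun u => (B - A) * (sin u * cos u))
      ((B - A) * (cos u * cos u + sin u * -sin u)) u :=
    ((hasDerivAt_sin u).mul (hasDerivAt_cos u)).const_mul _
  have h2 : HasDerivAt (fun u => A * cos u ^ 2 + B * sin u ^ 2)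
      (A * (2 * cos u * -sin u) + B * (2 * sin u * cos u)) u := by
    exact ((((hasDerivAt_cos u).pow 2).const_mul A).add
      (((hasDerivAt_sin u).pow 2).const_mul B)).congr_deriv (by simp)
  refine ((hasDerivAt_id u).add (h1.div h2 hden.ne').arctan).congr_deriv ?_
  set N := A * cos u ^ 2 + B * sin u ^ 2 with hN
  set D := ellipseSupport A B u
  -- Both sides are the squared modulus of $(A\cos u+iB\sin u)e^{-iu}$, whose argument is the
  -- arctangent term since its real part is positive.
  have key : N ^ 2 + ((B - A) * (sin u * cos u)) ^ 2 = D ^ 2 := by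
    rw [hsq, hN]
    linear_combination (A ^ 2 * cos u ^ 2 + B ^ 2 * sin u ^ 2) * hc
  have e1 : 1 + ((B - A) * (sin u * cos u) / N) ^ 2 = D ^ 2 / N ^ 2 := by
    rw [← key]; field_simp
  simp only [Pi.div_apply, ← hN]
  rw [e1]
  field_simp
  rw [hsq, hN]
  have hc' : cos u ^ 2 = 1 - sin u ^ 2 := by linarith
  ring_nf
  have hc4 : cos u ^ 4 = (1 - sin u ^ 2) ^ 2 := by rw [← hc']; ring
  rw [hc4, hc']
  ring

/-- Everything except the support function has an elementary primitive: the $p$ and $q$ terms are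
quarter-ellipse areas, the latter measured by the eccentric angle, and the $A^2$ term is the
derivative of $\sin u\cos u/D$ with $D$ the support function, which vanishes at both ends. -/
theorem integral_support_add {A B p q : ℝ} (hA : 0 < A) (hB : 0 < B) :
    ∫ u in (0 : ℝ)..π / 2, (ellipseSupport A B u + p * sin u ^ 2
        + q * (A * B * (B ^ 2 * sin u ^ 2) / ellipseSupport A B u ^ 4)
        - A ^ 2 * (cos u ^ 2 / ellipseSupport A B u
          - B ^ 2 * sin u ^ 2 / ellipseSupport A B u ^ 3)) =
      (∫ u in (0 : ℝ)..π / 2, ellipseSupport A B u) + π / 4 * p + π / 4 * q := by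
  have hD := continuous_ellipseSupport A B
  have hDne : ∀ u, ellipseSupport A B u ≠ 0 := fun u => (ellipseSupport_pos hA hB u).ne'
  have hder : ∀ u, HasDerivAt (fun u => p * ((u - sin u * cos u) / 2)
      + q * ((u + arctan ((B - A) * (sin u * cos u) / (A * cos u ^ 2 + B * sin u ^ 2))
        - A * B * (sin u / ellipseSupport A B u * (cos u / ellipseSupport A B u))) / 2)
      - A ^ 2 * (sin u * (cos u / ellipseSupport A B u)))
      (p * sin u ^ 2 + q * (A * B * (B ^ 2 * sin u ^ 2) / ellipseSupport A B u ^ 4)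
        - A ^ 2 * (cos u ^ 2 / ellipseSupport A B u
          - B ^ 2 * sin u ^ 2 / ellipseSupport A B u ^ 3)) u := fun u => by
    have hcd := hasDerivAt_cos_div_ellipseSupport hA hB u
    have hsd := hasDerivAt_sin_div_ellipseSupport hA hB u
    have h1 := (((hasDerivAt_id u).sub ((hasDerivAt_sin u).mul (hasDerivAt_cos u))).div_const
      2).const_mul p
    have h2 := ((((hasDerivAt_eccentricAngle hA hB u).sub
      ((hsd.mul hcd).const_mul (A * B)))).div_const 2).const_mul q
    have h3 := ((hasDerivAt_sin u).mul hcd).const_mul (A ^ 2)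
    refine ((h1.add h2).sub h3).congr_deriv ?_
    have hsq := ellipseSupport_sq A B u
    have hne := hDne u
    have hc := sin_sq_add_cos_sq u
    set D := ellipseSupport A B u
    have e1 : (1 - (cos u * cos u + sin u * -sin u)) / 2 = sin u ^ 2 := by linarith
    have e2 : (A * B / D ^ 2 - A * B * (A ^ 2 * cos u / D ^ 3 * (cos u / D)
        + sin u / D * -(B ^ 2 * sin u / D ^ 3))) / 2
        = A * B * (B ^ 2 * sin u ^ 2) / D ^ 4 := by
      field_simp
      rw [hsq]
      ring
    rw [e1, e2]
    field_simp
    ring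
  have hcont : Continuous fun u => p * sin u ^ 2
      + q * (A * B * (B ^ 2 * sin u ^ 2) / ellipseSupport A B u ^ 4)
        - A ^ 2 * (cos u ^ 2 / ellipseSupport A B u
          - B ^ 2 * sin u ^ 2 / ellipseSupport A B u ^ 3) := by
    fun_prop (disch := intro u; exact pow_ne_zero _ (hDne u))
  have hint := intervalIntegral.integral_eq_sub_of_hasDerivAt
    (a := 0) (b := π / 2) (fun u _ => hder u) (hcont.intervalIntegrable _ _)
  have : (∫ u in (0 : ℝ)..π / 2, (ellipseSupport A B u + p * sin u ^ 2
        + q * (A * B * (B ^ 2 * sin u ^ 2) / ellipseSupport A B u ^ 4)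
        - A ^ 2 * (cos u ^ 2 / ellipseSupport A B u
          - B ^ 2 * sin u ^ 2 / ellipseSupport A B u ^ 3))) =
      ∫ u in (0 : ℝ)..π / 2, (ellipseSupport A B u + (p * sin u ^ 2
        + q * (A * B * (B ^ 2 * sin u ^ 2) / ellipseSupport A B u ^ 4)
        - A ^ 2 * (cos u ^ 2 / ellipseSupport A B u
          - B ^ 2 * sin u ^ 2 / ellipseSupport A B u ^ 3))) := by
    congr 1; ext u; ring
  rw [this, intervalIntegral.integral_add (hD.intervalIntegrable _ _)
    (hcont.intervalIntegrable _ _), hint]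
  simp
  ring

/-! ### Area of the Minkowski sum of two ellipses -/

theorem mem_planarEllipse_add {a₁ b₁ a₂ b₂ : ℝ} {q : ℝ × ℝ} :
    q ∈ planarEllipse a₁ b₁ + planarEllipse a₂ b₂ ↔
    ∃ u v u' v' : ℝ, u ^ 2 + v ^ 2 ≤ 1 ∧ u' ^ 2 + v' ^ 2 ≤ 1 ∧
      q.1 = a₁ * u + a₂ * u' ∧ q.2 = b₁ * v + b₂ * v' := by
  constructor
  · rintro ⟨q₁, ⟨u, v, h, h1, h2⟩, q₂, ⟨u', v', h', h1', h2'⟩, rfl⟩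
    exact ⟨u, v, u', v', h, h', by simp [h1, h1'], by simp [h2, h2']⟩
  · rintro ⟨u, v, u', v', h, h', h1, h2⟩
    exact ⟨(a₁ * u, b₁ * v), ⟨u, v, h, rfl, rfl⟩, (a₂ * u', b₂ * v'), ⟨u', v', h', rfl, rfl⟩,
      by ext <;> simp [h1, h2]⟩

theorem isCompact_unitDisc : IsCompact {w : ℝ × ℝ | w.1 ^ 2 + w.2 ^ 2 ≤ 1} := by
  refine Metric.isCompact_of_isClosed_isBounded
    (isClosed_le (by fun_prop) continuous_const) ?_
  refine (Metric.isBounded_closedBall (x := (0 : ℝ × ℝ)) (r := 1)).subset ?_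
  intro w hw
  rw [mem_ofPred_eq] at hw
  rw [mem_closedBall_zero_iff, Prod.norm_def, sup_le_iff, norm_eq_abs, norm_eq_abs]
  exact ⟨abs_le_of_sq_le_sq (by nlinarith [sq_nonneg w.2]) one_pos.le,
    abs_le_of_sq_le_sq (by nlinarith [sq_nonneg w.1]) one_pos.le⟩

theorem planarEllipse_eq_image (a b : ℝ) : planarEllipse a b =
    (fun w : ℝ × ℝ => (a * w.1, b * w.2)) '' {w : ℝ × ℝ | w.1 ^ 2 + w.2 ^ 2 ≤ 1} := by
  ext q
  constructor
  · rintro ⟨u, v, h, h1, h2⟩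
    exact ⟨(u, v), h, by ext <;> simp [h1, h2]⟩
  · rintro ⟨w, h, rfl⟩
    exact ⟨w.1, w.2, h, rfl, rfl⟩

theorem isCompact_planarEllipse (a b : ℝ) : IsCompact (planarEllipse a b) := by
  rw [planarEllipse_eq_image]
  exact isCompact_unitDisc.image (by fun_prop)

theorem abs_le_one_of_sq_add_sq_le {u v : ℝ} (h : u ^ 2 + v ^ 2 ≤ 1) : |u| ≤ 1 :=
  abs_le_of_sq_le_sq (by nlinarith [sq_nonneg v]) one_pos.le

theorem mul_add_mul_le_sqrt {x y u v : ℝ} (h : u ^ 2 + v ^ 2 ≤ 1) :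
    x * u + y * v ≤ √(x ^ 2 + y ^ 2) := by
  apply le_sqrt_of_sq_le
  nlinarith [sq_nonneg (x * v - y * u), sq_nonneg x, sq_nonneg y]

theorem planarEllipse_add_fst_le {a₁ b₁ a₂ b₂ : ℝ} (ha₁ : 0 ≤ a₁) (ha₂ : 0 ≤ a₂) {q : ℝ × ℝ}
    (hq : q ∈ planarEllipse a₁ b₁ + planarEllipse a₂ b₂) : q.1 ≤ a₁ + a₂ := by
  obtain ⟨u, v, u', v', h, h', h1, -⟩ := mem_planarEllipse_add.1 hq
  have := (abs_le.1 (abs_le_one_of_sq_add_sq_le h)).2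
  have := (abs_le.1 (abs_le_one_of_sq_add_sq_le h')).2
  rw [h1]
  nlinarith

/-- The vertical slices of the Minkowski sum of two ellipses, in terms of the parametrization of
its boundary by the eccentric angle `t` of the second one. -/
theorem slice_planarEllipse_add {a₁ b₁ a₂ b₂ : ℝ} (ha₁ : 0 < a₁) (hb₁ : 0 < b₁) (ha₂ : 0 < a₂)
    (hb₂ : 0 < b₂) {t : ℝ} (ht : t ∈ Ioo 0 (π / 2)) :
    Prod.mk (a₂ * cos t + a₁ ^ 2 * b₂ * (cos t / ellipseSupport (a₁ * b₂) (b₁ * a₂) t)) ⁻¹'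
      (planarEllipse a₁ b₁ + planarEllipse a₂ b₂) =
    Icc (-(b₂ * sin t + b₁ ^ 2 * a₂ * (sin t / ellipseSupport (a₁ * b₂) (b₁ * a₂) t)))
      (b₂ * sin t + b₁ ^ 2 * a₂ * (sin t / ellipseSupport (a₁ * b₂) (b₁ * a₂) t)) := by
  have hD := ellipseSupport_pos (mul_pos ha₁ hb₂) (mul_pos hb₁ ha₂) t
  have hsq := ellipseSupport_sq (a₁ * b₂) (b₁ * a₂) t
  have hsin : 0 < sin t := sin_pos_of_pos_of_lt_pi ht.1 (by linarith [ht.2, pi_pos])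
  have hc := sin_sq_add_cos_sq t
  have hsup : ∀ u v : ℝ, u ^ 2 + v ^ 2 ≤ 1 → a₁ * b₂ * cos t * u + b₁ * a₂ * sin t * v ≤
      ellipseSupport (a₁ * b₂) (b₁ * a₂) t := fun u v h => mul_add_mul_le_sqrt h
  have hcir : ∀ u v : ℝ, u ^ 2 + v ^ 2 ≤ 1 → cos t * u + sin t * v ≤ 1 := fun u v h => by
    have := mul_add_mul_le_sqrt (x := cos t) (y := sin t) h
    rwa [add_comm (cos t ^ 2), hc, sqrt_one] at this
  set D := ellipseSupport (a₁ * b₂) (b₁ * a₂) t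
  have hunit : (a₁ * b₂ * cos t / D) ^ 2 + (b₁ * a₂ * sin t / D) ^ 2 = 1 := by
    rw [div_pow, div_pow, ← add_div, ← hsq, div_self (by positivity)]
  -- The support inequality for the normal $(b_2\cos t,a_2\sin t)$ of the second ellipse at
  -- eccentric angle $t$: the first ellipse has support value $D$ there, the second $a_2b_2$, and by
  -- `e3` the claimed boundary point attains the sum.
  have hsupp : ∀ u v u' v' : ℝ, u ^ 2 + v ^ 2 ≤ 1 → u' ^ 2 + v' ^ 2 ≤ 1 →
      a₂ * cos t + a₁ ^ 2 * b₂ * (cos t / D) = a₁ * u + a₂ * u' →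
      b₁ * v + b₂ * v' ≤ b₂ * sin t + b₁ ^ 2 * a₂ * (sin t / D) := fun u v u' v' h h' h1 => by
    have e1 := hsup u v h
    have e2 := mul_le_mul_of_nonneg_left (hcir u' v' h') (mul_pos ha₂ hb₂).le
    have e3 : b₂ * cos t * (a₂ * cos t + a₁ ^ 2 * b₂ * (cos t / D)) +
        a₂ * sin t * (b₂ * sin t + b₁ ^ 2 * a₂ * (sin t / D)) = a₂ * b₂ + D := by
      have : a₂ * b₂ + D = a₂ * b₂ * (sin t ^ 2 + cos t ^ 2) + D ^ 2 / D := by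
        rw [hc]; field_simp
      rw [this, hsq]
      field_simp
      ring
    refine le_of_mul_le_mul_left ?_ (mul_pos ha₂ hsin)
    rw [h1] at e3
    linarith
  ext y
  rw [mem_preimage, mem_planarEllipse_add]
  constructor
  · rintro ⟨u, v, u', v', h, h', h1, h2⟩
    simp only at h1 h2
    rw [h2]
    have := hsupp u (-v) u' (-v') (by simpa using h) (by simpa using h') h1
    exact ⟨by linarith, hsupp u v u' v' h h' h1⟩
  · intro hy
    set Y := b₂ * sin t + b₁ ^ 2 * a₂ * (sin t / D) with hY
    have hYpos : 0 < Y := by positivity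
    have hl : (y / Y) ^ 2 ≤ 1 := by
      rw [sq_le_one_iff_abs_le_one, abs_div, abs_of_pos hYpos, div_le_one hYpos]
      exact abs_le.2 hy
    -- The two boundary points with common normal, with their vertical coordinates shrunk by the
    -- same factor $y/Y$; the abscissa is unaffected.
    refine ⟨a₁ * b₂ * cos t / D, y / Y * (b₁ * a₂ * sin t / D), cos t, y / Y * sin t, ?_, ?_,
      ?_, ?_⟩
    · rw [mul_pow]
      nlinarith [sq_nonneg (b₁ * a₂ * sin t / D)]
    · rw [mul_pow]
      nlinarith [sq_nonneg (sin t)]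
    · simp only; ring
    · simp only
      have : b₁ * (y / Y * (b₁ * a₂ * sin t / D)) + b₂ * (y / Y * sin t) = y / Y * Y := by
        rw [hY]; ring
      rw [this]
      field_simp

/-- The area of the Minkowski sum of two ellipses with the same axes. -/
def sumArea (a₁ b₁ a₂ b₂ : ℝ) : ℝ :=
  π * (a₁ * b₁ + a₂ * b₂) + 4 * ∫ t in (0 : ℝ)..π / 2, ellipseSupport (a₁ * b₂) (b₁ * a₂) t

theorem volume_planarEllipse_add_of_pos {a₁ b₁ a₂ b₂ : ℝ} (ha₁ : 0 < a₁) (hb₁ : 0 < b₁)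
    (ha₂ : 0 < a₂) (hb₂ : 0 < b₂) :
    volume (planarEllipse a₁ b₁ + planarEllipse a₂ b₂) =
      ENNReal.ofReal (sumArea a₁ b₁ a₂ b₂) := by
  have hA := mul_pos ha₁ hb₂
  have hB := mul_pos hb₁ ha₂
  set D := ellipseSupport (a₁ * b₂) (b₁ * a₂) with hDdef
  have hDcont : Continuous D := continuous_ellipseSupport _ _
  have hDpos : ∀ u, 0 < D u := ellipseSupport_pos hA hB
  set f : ℝ → ℝ := fun t => a₂ * cos t + a₁ ^ 2 * b₂ * (cos t / D t) with hf
  set g : ℝ → ℝ := fun t => b₂ * sin t + b₁ ^ 2 * a₂ * (sin t / D t) with hg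
  set f' : ℝ → ℝ := fun t => -(a₂ * sin t + a₁ ^ 2 * b₂ * ((b₁ * a₂) ^ 2 * sin t / D t ^ 3))
    with hf'
  have hderiv : ∀ t, HasDerivAt f (f' t) t := fun t =>
    (((hasDerivAt_cos t).const_mul a₂).add
      ((hasDerivAt_cos_div_ellipseSupport hA hB t).const_mul (a₁ ^ 2 * b₂))).congr_deriv
      (by simp only [hf', hDdef]; ring)
  have hfcont : Continuous f := continuous_iff_continuousAt.2 fun t => (hderiv t).continuousAt
  have hsin : ∀ t ∈ Ioo 0 (π / 2), 0 < sin t := fun t ht =>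
    sin_pos_of_pos_of_lt_pi ht.1 (by linarith [ht.2, pi_pos])
  have hf'neg : ∀ t ∈ Ioo 0 (π / 2), f' t < 0 := fun t ht => by
    have := hsin t ht
    have := hDpos t
    simp only [hf', neg_lt_zero]
    positivity
  have hanti : StrictAntiOn f (Icc 0 (π / 2)) := by
    refine strictAntiOn_of_deriv_neg (convex_Icc _ _) hfcont.continuousOn fun t ht => ?_
    rw [interior_Icc] at ht
    rw [(hderiv t).deriv]
    exact hf'neg t ht
  have hpi : (0 : ℝ) ≤ π / 2 := by positivity
  have hf0 : f 0 = a₁ + a₂ := by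
    have : D 0 = a₁ * b₂ := by
      simp only [hDdef, ellipseSupport, cos_zero, sin_zero, mul_one, mul_zero]
      rw [zero_pow two_ne_zero, add_zero, sqrt_sq hA.le]
    simp only [hf, this, cos_zero]
    field_simp
    ring
  have hf1 : f (π / 2) = 0 := by simp [hf]
  have himage : f '' Ioo 0 (π / 2) = Ioo (f (π / 2)) (f 0) := by
    apply Subset.antisymm
    · rintro _ ⟨t, ht, rfl⟩
      have ht' := Ioo_subset_Icc_self ht
      exact ⟨hanti ht' (right_mem_Icc.2 hpi) ht.2, hanti (left_mem_Icc.2 hpi) ht' ht.1⟩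
    · exact intermediate_value_Ioo' hpi hfcont.continuousOn
  rw [hf0, hf1] at himage
  have hmeas : MeasurableSet (planarEllipse a₁ b₁ + planarEllipse a₂ b₂) :=
    ((isCompact_planarEllipse _ _).add (isCompact_planarEllipse _ _)).isClosed.measurableSet
  have hsymm : ∀ x y, (x, y) ∈ planarEllipse a₁ b₁ + planarEllipse a₂ b₂ →
      (-x, y) ∈ planarEllipse a₁ b₁ + planarEllipse a₂ b₂ := fun x y h => by
    obtain ⟨u, v, u', v', h, h', h1, h2⟩ := mem_planarEllipse_add.1 h
    refine mem_planarEllipse_add.2 ⟨-u, v, -u', v', by simpa using h, by simpa using h', ?_, h2⟩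
    simp only at h1 ⊢
    linarith
  -- The eccentric angle $t$ replaces the abscissa $x=f(t)$, and the slice at $f(t)$ has length
  -- $2g(t)$.
  rw [volume_eq_two_mul_lintegral_slice hmeas hsymm
    (fun q hq => planarEllipse_add_fst_le ha₁.le ha₂.le hq), ← himage,
    lintegral_image_eq_lintegral_abs_deriv_mul measurableSet_Ioo
      (fun t _ => (hderiv t).hasDerivWithinAt) (hanti.injOn.mono Ioo_subset_Icc_self)]
  have hcontint : Continuous fun t => -f' t * (2 * g t) := by
    simp only [hf', hg]
    fun_prop (disch := intro u; first | exact pow_ne_zero _ (hDpos u).ne' | exact (hDpos u).ne')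
  have hstep : ∫⁻ t in Ioo 0 (π / 2), ENNReal.ofReal |f' t| *
      volume (Prod.mk (f t) ⁻¹' (planarEllipse a₁ b₁ + planarEllipse a₂ b₂)) =
      ∫⁻ t in Ioo 0 (π / 2), ENNReal.ofReal (-f' t * (2 * g t)) := by
    refine setLIntegral_congr_fun measurableSet_Ioo fun t ht => ?_
    simp only [hf]
    rw [slice_planarEllipse_add ha₁ hb₁ ha₂ hb₂ ht, Real.volume_Icc, abs_of_neg (hf'neg t ht),
      ENNReal.ofReal_mul (by linarith [hf'neg t ht])]
    congr 2
    simp only [hg]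
    ring
  rw [hstep, ← ofReal_integral_eq_lintegral_ofReal, ← integral_Ioc_eq_integral_Ioo,
    ← intervalIntegral.integral_of_le hpi]
  rotate_left
  · exact (hcontint.integrableOn_Icc (a := 0) (b := π / 2)).mono_set Ioo_subset_Icc_self
  · refine (ae_restrict_iff' measurableSet_Ioo).2 (ae_of_all _ fun t ht => ?_)
    have h1 := hf'neg t ht
    have h2 := hsin t ht
    have h3 := hDpos t
    have : 0 < g t := by simp only [hg]; positivity
    have : 0 < -f' t := by linarith
    simp only [Pi.zero_apply]
    positivity
  have heq : ∫ t in (0 : ℝ)..π / 2, -f' t * (2 * g t) =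
      2 * ∫ u in (0 : ℝ)..π / 2, (D u + a₂ * b₂ * sin u ^ 2
        + a₁ * b₁ * (a₁ * b₂ * (b₁ * a₂) * ((b₁ * a₂) ^ 2 * sin u ^ 2) / D u ^ 4)
        - (a₁ * b₂) ^ 2 * (cos u ^ 2 / D u - (b₁ * a₂) ^ 2 * sin u ^ 2 / D u ^ 3)) := by
    rw [← intervalIntegral.integral_const_mul]
    congr 1
    ext u
    have hne := (hDpos u).ne'
    have hsq : D u ^ 2 = _ := ellipseSupport_sq (a₁ * b₂) (b₁ * a₂) u
    -- The product $-f'g$ contains $B^2\sin^2u/D$ (here $A=a_1b_2$, $B=b_1a_2$); trading it for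
    -- $D-A^2\cos^2u/D$ leaves $D$ plus terms with elementary primitives.
    have h1 : D u - (a₁ * b₂) ^ 2 * (cos u ^ 2 / D u) = (b₁ * a₂) ^ 2 * sin u ^ 2 / D u := by
      field_simp
      rw [hsq]
      ring
    have h2 : D u + a₂ * b₂ * sin u ^ 2
        + a₁ * b₁ * (a₁ * b₂ * (b₁ * a₂) * ((b₁ * a₂) ^ 2 * sin u ^ 2) / D u ^ 4)
        - (a₁ * b₂) ^ 2 * (cos u ^ 2 / D u - (b₁ * a₂) ^ 2 * sin u ^ 2 / D u ^ 3) =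
      (b₁ * a₂) ^ 2 * sin u ^ 2 / D u + a₂ * b₂ * sin u ^ 2
        + a₁ * b₁ * (a₁ * b₂ * (b₁ * a₂) * ((b₁ * a₂) ^ 2 * sin u ^ 2) / D u ^ 4)
        + (a₁ * b₂) ^ 2 * ((b₁ * a₂) ^ 2 * sin u ^ 2 / D u ^ 3) := by
      rw [← h1]; ring
    rw [h2]
    simp only [hf', hg]
    field_simp
    ring
  rw [heq, integral_support_add hA hB, ← ENNReal.ofReal_ofNat 2,
    ← ENNReal.ofReal_mul two_pos.le]
  congr 1
  rw [sumArea]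
  ring

theorem continuous_sumArea :
    Continuous fun p : ℝ × ℝ × ℝ × ℝ => sumArea p.1 p.2.1 p.2.2.1 p.2.2.2 := by
  unfold sumArea ellipseSupport
  have : Continuous fun p : ℝ × ℝ × ℝ × ℝ => ∫ t in (0 : ℝ)..π / 2,
      √((p.1 * p.2.2.2 * cos t) ^ 2 + (p.2.1 * p.2.2.1 * sin t) ^ 2) :=
    intervalIntegral.continuous_parametric_intervalIntegral_of_continuous' (by fun_prop) _ _
  fun_prop

theorem planarEllipse_mono {a b a' b' : ℝ} (ha : 0 ≤ a) (hb : 0 ≤ b) (haa : a ≤ a')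
    (hbb : b ≤ b') : planarEllipse a b ⊆ planarEllipse a' b' := by
  have aux : ∀ {x y u : ℝ}, 0 ≤ x → x ≤ y → x * u = y * (x / y * u) ∧ (x / y * u) ^ 2 ≤ u ^ 2 := by
    intro x y u hx hxy
    rcases hx.eq_or_lt with rfl | hx'
    · simp [sq_nonneg]
    have hy : 0 < y := hx'.trans_le hxy
    refine ⟨by field_simp, ?_⟩
    rw [mul_pow]
    have : (x / y) ^ 2 ≤ 1 := pow_le_one₀ (by positivity) ((div_le_one hy).2 hxy)
    nlinarith [sq_nonneg u]
  rintro q ⟨u, v, h, h1, h2⟩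
  obtain ⟨e1, e2⟩ := aux (u := u) ha haa
  obtain ⟨e3, e4⟩ := aux (u := v) hb hbb
  exact ⟨a / a' * u, b / b' * v, by linarith, by rw [h1, e1], by rw [h2, e3]⟩

/-- The disc parameters witnessing membership range over a compact set, so a subsequence converges,
and its limit witnesses membership in the limiting sum. -/
theorem iInter_planarEllipse_add {ε : ℕ → ℝ} (hε : Filter.Tendsto ε Filter.atTop (nhds 0))
    (a₁ b₁ a₂ b₂ : ℝ) :
    ⋂ n, (planarEllipse (a₁ + ε n) (b₁ + ε n) + planarEllipse (a₂ + ε n) (b₂ + ε n)) ⊆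
      planarEllipse a₁ b₁ + planarEllipse a₂ b₂ := by
  intro q hq
  have hq' := fun n => mem_planarEllipse_add.1 (mem_iInter.1 hq n)
  choose u v u' v' h h' h1 h2 using hq'
  obtain ⟨⟨w, w'⟩, ⟨hw, hw'⟩, φ, hφ, hlim⟩ :=
    (isCompact_unitDisc.prod isCompact_unitDisc).tendsto_subseq
      (x := fun n => ((u n, v n), (u' n, v' n))) (fun n => ⟨h n, h' n⟩)
  have hε' := hε.comp hφ.tendsto_atTop
  have hl1 := (hlim.fst_nhds).fst_nhds
  have hl2 := (hlim.fst_nhds).snd_nhds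
  have hl3 := (hlim.snd_nhds).fst_nhds
  have hl4 := (hlim.snd_nhds).snd_nhds
  refine mem_planarEllipse_add.2 ⟨w.1, w.2, w'.1, w'.2, hw, hw', ?_, ?_⟩
  · have hlim1 := ((hε'.const_add a₁).mul hl1).add ((hε'.const_add a₂).mul hl3)
    rw [add_zero, add_zero] at hlim1
    refine tendsto_nhds_unique (tendsto_const_nhds.congr fun n => ?_) hlim1
    exact h1 (φ n)
  · have hlim1 := ((hε'.const_add b₁).mul hl2).add ((hε'.const_add b₂).mul hl4)
    rw [add_zero, add_zero] at hlim1
    refine tendsto_nhds_unique (tendsto_const_nhds.congr fun n => ?_) hlim1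
    exact h2 (φ n)

/-- Vanishing semi-axes escape the boundary parametrization. Enlarging all semi-axes by
$\varepsilon_n\downarrow0$ gives a decreasing sequence of compact sums with the right intersection;
measure is continuous from above and the formula is continuous in the semi-axes. -/
theorem volume_planarEllipse_add {a₁ b₁ a₂ b₂ : ℝ} (ha₁ : 0 ≤ a₁) (hb₁ : 0 ≤ b₁)
    (ha₂ : 0 ≤ a₂) (hb₂ : 0 ≤ b₂) :
    volume (planarEllipse a₁ b₁ + planarEllipse a₂ b₂) =
      ENNReal.ofReal (sumArea a₁ b₁ a₂ b₂) := by
  set ε : ℕ → ℝ := fun n => 1 / ((n : ℝ) + 1) with hεdef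
  have hε : Filter.Tendsto ε Filter.atTop (nhds 0) := tendsto_one_div_add_atTop_nhds_zero_nat
  have hpos : ∀ n, 0 < ε n := fun n => by simp only [hεdef]; positivity
  have hanti : Antitone ε := fun m n hmn => one_div_le_one_div_of_le (by positivity)
    (by have : (m : ℝ) ≤ n := by exact_mod_cast hmn
        linarith)
  set s : ℕ → Set (ℝ × ℝ) := fun n =>
    planarEllipse (a₁ + ε n) (b₁ + ε n) + planarEllipse (a₂ + ε n) (b₂ + ε n) with hs
  have hvol : ∀ n, volume (s n) =
      ENNReal.ofReal (sumArea (a₁ + ε n) (b₁ + ε n) (a₂ + ε n) (b₂ + ε n)) := fun n =>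
    volume_planarEllipse_add_of_pos (by linarith [hpos n]) (by linarith [hpos n])
      (by linarith [hpos n]) (by linarith [hpos n])
  have hsanti : Antitone s := fun m n hmn => by
    have := hanti hmn
    have := hpos n
    exact add_subset_add
      (planarEllipse_mono (by linarith) (by linarith) (by linarith) (by linarith))
      (planarEllipse_mono (by linarith) (by linarith) (by linarith) (by linarith))
  have hInter : ⋂ n, s n = planarEllipse a₁ b₁ + planarEllipse a₂ b₂ := by
    refine Subset.antisymm (iInter_planarEllipse_add hε _ _ _ _) (subset_iInter fun n => ?_)
    have := hpos n
    exact add_subset_add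
      (planarEllipse_mono (by linarith) (by linarith) (by linarith) (by linarith))
      (planarEllipse_mono (by linarith) (by linarith) (by linarith) (by linarith))
  have hlim := tendsto_measure_iInter_atTop (μ := volume)
    (fun n => ((isCompact_planarEllipse _ _).add
      (isCompact_planarEllipse _ _)).isClosed.measurableSet.nullMeasurableSet) hsanti
    ⟨0, by rw [hvol]; exact ENNReal.ofReal_ne_top⟩
  rw [hInter] at hlim
  refine tendsto_nhds_unique hlim ?_
  have hpar : Filter.Tendsto (fun n => (a₁ + ε n, b₁ + ε n, a₂ + ε n, b₂ + ε n)) Filter.atTop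
      (nhds (a₁, b₁, a₂, b₂)) := by
    have h := fun x : ℝ => hε.const_add x
    simp only [add_zero] at h
    exact (h a₁).prodMk_nhds ((h b₁).prodMk_nhds ((h a₂).prodMk_nhds (h b₂)))
  exact (ENNReal.tendsto_ofReal ((continuous_sumArea.tendsto _).comp hpar)).congr
    fun n => (hvol n).symm

theorem sumArea_nonneg {a₁ b₁ a₂ b₂ : ℝ} (ha₁ : 0 ≤ a₁) (hb₁ : 0 ≤ b₁)
    (ha₂ : 0 ≤ a₂) (hb₂ : 0 ≤ b₂) : 0 ≤ sumArea a₁ b₁ a₂ b₂ := by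
  have : 0 ≤ ∫ t in (0 : ℝ)..π / 2, ellipseSupport (a₁ * b₂) (b₁ * a₂) t :=
    intervalIntegral.integral_nonneg (by positivity) fun t _ => sqrt_nonneg _
  unfold sumArea
  positivity

theorem volume_ellipse_add {a₁ b₁ a₂ b₂ : ℝ} (ha₁ : 0 ≤ a₁) (hb₁ : 0 ≤ b₁)
    (ha₂ : 0 ≤ a₂) (hb₂ : 0 ≤ b₂) :
    volume (ellipse a₁ b₁ + ellipse a₂ b₂) = ENNReal.ofReal (sumArea a₁ b₁ a₂ b₂) := by
  rw [ellipse_eq_image, ellipse_eq_image, ← Set.image_add rot.symm, volume_rot_symm_image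
    ((isCompact_planarEllipse _ _).add (isCompact_planarEllipse _ _)).isClosed.measurableSet,
    volume_planarEllipse_add ha₁ hb₁ ha₂ hb₂]

/-! ### Area of the convex hull of two ellipses inscribed in a square -/

theorem isCompact_convexHull_union {E : Type*} [AddCommGroup E] [Module ℝ E] [TopologicalSpace E]
    [IsTopologicalAddGroup E] [ContinuousSMul ℝ E] {A B : Set E} (hA : IsCompact A)
    (hB : IsCompact B) (hA' : Convex ℝ A) (hB' : Convex ℝ B) (hA₀ : A.Nonempty)
    (hB₀ : B.Nonempty) : IsCompact (convexHull ℝ (A ∪ B)) := by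
  have : convexHull ℝ (A ∪ B) = (fun p : ℝ × E × E => (1 - p.1) • p.2.1 + p.1 • p.2.2) ''
      (Icc 0 1 ×ˢ A ×ˢ B) := by
    rw [hA'.convexHull_union hB' hA₀ hB₀]
    ext x
    simp only [mem_convexJoin, segment_eq_image, mem_image, mem_prod, Prod.exists]
    constructor
    · rintro ⟨a, ha, b, hb, t, ht, rfl⟩
      exact ⟨t, a, b, ⟨ht, ha, hb⟩, rfl⟩
    · rintro ⟨t, a, b, ⟨ht, ha, hb⟩, rfl⟩
      exact ⟨a, ha, b, hb, t, ht, rfl⟩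
  rw [this]
  exact (isCompact_Icc.prod (hA.prod hB)).image (by fun_prop)

theorem convex_unitDisc : Convex ℝ {w : ℝ × ℝ | w.1 ^ 2 + w.2 ^ 2 ≤ 1} := by
  intro w hw z hz s t hs ht hst
  simp only [mem_ofPred_eq, Prod.fst_add, Prod.snd_add, Prod.smul_fst, Prod.smul_snd,
    smul_eq_mul] at *
  have h1 : w.1 * z.1 + w.2 * z.2 ≤ 1 := by
    nlinarith [sq_nonneg (w.1 - z.1), sq_nonneg (w.2 - z.2)]
  have h2 : (s + t) ^ 2 = 1 := by rw [hst, one_pow]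
  nlinarith [mul_nonneg hs ht, sq_nonneg s, sq_nonneg t]

theorem convex_planarEllipse (a b : ℝ) : Convex ℝ (planarEllipse a b) := by
  rw [planarEllipse_eq_image]
  refine convex_unitDisc.is_linear_image ⟨fun x y => ?_, fun c x => ?_⟩
  · ext <;> simp <;> ring
  · ext <;> simp <;> ring

theorem planarEllipse_nonempty (a b : ℝ) : (planarEllipse a b).Nonempty :=
  ⟨(0, 0), 0, 0, by simp⟩

theorem setLIntegral_Ioo_add {F : ℝ → ENNReal} {a b c : ℝ} (hab : a ≤ b) (hbc : b ≤ c) :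
    ∫⁻ x in Ioo a c, F x = (∫⁻ x in Ioo a b, F x) + ∫⁻ x in Ioo b c, F x := by
  simp only [restrict_Ioo_eq_restrict_Ioc]
  rw [← Ioc_union_Ioc_eq_Ioc hab hbc, lintegral_union measurableSet_Ioc]
  exact Ioc_disjoint_Ioc_of_le le_rfl

/-- The area under an arc of an ellipse. -/
theorem setLIntegral_ellipse_arc {F : ℝ → ENNReal} {a b p q : ℝ} (ha : 0 ≤ a) (hb : 0 ≤ b)
    (hp : 0 ≤ p) (hpq : p ≤ q) (hq : q ≤ π / 2)
    (hF : 0 < a → ∀ u ∈ Ioo p q, F (a * cos u) = ENNReal.ofReal (2 * (b * sin u))) :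
    ∫⁻ x in Ioo (a * cos q) (a * cos p), F x =
      ENNReal.ofReal (a * b * (sin p * cos p - sin q * cos q + q - p)) := by
  rcases ha.eq_or_lt with rfl | ha
  · simp
  have hIcc : Icc p q ⊆ Icc 0 π := Icc_subset_Icc hp (by linarith [pi_pos])
  have hanti : StrictAntiOn (fun u => a * cos u) (Icc p q) := fun x hx y hy hxy =>
    mul_lt_mul_of_pos_left (strictAntiOn_cos (hIcc hx) (hIcc hy) hxy) ha
  have himage : (fun u => a * cos u) '' Ioo p q = Ioo (a * cos q) (a * cos p) := by
    apply Subset.antisymm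
    · rintro _ ⟨t, ht, rfl⟩
      have ht' := Ioo_subset_Icc_self ht
      exact ⟨hanti ht' (right_mem_Icc.2 hpq) ht.2, hanti (left_mem_Icc.2 hpq) ht' ht.1⟩
    · exact intermediate_value_Ioo' (f := fun u => a * cos u) hpq
        (continuous_cos.const_mul a).continuousOn
  have hsin : ∀ u ∈ Ioo p q, 0 < sin u := fun u hu =>
    sin_pos_of_pos_of_lt_pi (by linarith [hu.1]) (by linarith [hu.2, pi_pos])
  rw [← himage, lintegral_image_eq_lintegral_abs_deriv_mul measurableSet_Ioo
      (fun t _ => ((hasDerivAt_cos t).const_mul a).hasDerivWithinAt)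
      (hanti.injOn.mono Ioo_subset_Icc_self)]
  have hstep : ∫⁻ t in Ioo p q, ENNReal.ofReal |a * -sin t| * F (a * cos t) =
      ∫⁻ t in Ioo p q, ENNReal.ofReal (2 * (a * b) * sin t ^ 2) := by
    refine setLIntegral_congr_fun measurableSet_Ioo fun t ht => ?_
    have := hsin t ht
    rw [hF ha t ht, ← ENNReal.ofReal_mul (abs_nonneg _), mul_neg, abs_neg,
      abs_of_pos (by positivity)]
    congr 1
    ring
  have hcont : Continuous fun t => 2 * (a * b) * sin t ^ 2 := by fun_prop
  rw [hstep, ← ofReal_integral_eq_lintegral_ofReal, ← integral_Ioc_eq_integral_Ioo,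
    ← intervalIntegral.integral_of_le hpq, intervalIntegral.integral_const_mul, integral_sin_sq]
  · congr 1; ring
  · exact (hcont.integrableOn_Icc (a := p) (b := q)).mono_set Ioo_subset_Icc_self
  · exact ae_of_all _ fun t => by simp only [Pi.zero_apply]; positivity

theorem setLIntegral_line {F : ℝ → ENNReal} {c p q : ℝ} (hpq : p ≤ q) (hq : q ≤ c)
    (hF : ∀ x ∈ Ioo p q, F x = ENNReal.ofReal (2 * (c - x))) :
    ∫⁻ x in Ioo p q, F x = ENNReal.ofReal ((q - p) * (2 * c - p - q)) := by
  have hcont : Continuous fun x : ℝ => 2 * (c - x) := by fun_prop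
  rw [setLIntegral_congr_fun measurableSet_Ioo hF, ← ofReal_integral_eq_lintegral_ofReal,
    ← integral_Ioc_eq_integral_Ioo, ← intervalIntegral.integral_of_le hpq,
    intervalIntegral.integral_const_mul, intervalIntegral.integral_sub (by simp) (by simp),
    integral_id, intervalIntegral.integral_const, smul_eq_mul]
  · congr 1; ring
  · exact (hcont.integrableOn_Icc (a := p) (b := q)).mono_set Ioo_subset_Icc_self
  · refine (ae_restrict_iff' measurableSet_Ioo).2 (ae_of_all _ fun t ht => ?_)
    have := ht.2
    simp only [Pi.zero_apply]
    linarith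

theorem exists_eq_mul_of_abs_le {y Y : ℝ} (h : |y| ≤ Y) : ∃ l : ℝ, l ^ 2 ≤ 1 ∧ y = l * Y := by
  have hY : 0 ≤ Y := (abs_nonneg y).trans h
  rcases hY.eq_or_lt with rfl | hY
  · exact ⟨0, by norm_num, by simpa using h⟩
  · refine ⟨y / Y, ?_, by field_simp⟩
    rw [sq_le_one_iff_abs_le_one, abs_div, abs_of_pos hY, div_le_one hY]
    exact h

/-- The support inequality for the convex hull of two ellipses. -/
theorem add_mul_abs_le_of_mem_convexHull {a₁ b₁ a₂ b₂ n m M : ℝ} (hM : 0 ≤ M)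
    (h₁ : (n * a₁) ^ 2 + (m * b₁) ^ 2 ≤ M ^ 2) (h₂ : (n * a₂) ^ 2 + (m * b₂) ^ 2 ≤ M ^ 2)
    {q : ℝ × ℝ} (hq : q ∈ convexHull ℝ (planarEllipse a₁ b₁ ∪ planarEllipse a₂ b₂)) :
    n * q.1 + m * |q.2| ≤ M := by
  -- The half-planes with normals $(n,m)$ and $(n,-m)$ both contain the two ellipses, which are
  -- symmetric about the horizontal axis.
  have aux : ∀ k : ℝ, k ^ 2 = m ^ 2 → n * q.1 + k * q.2 ≤ M := fun k hk => by
    have hconv : Convex ℝ {q : ℝ × ℝ | n * q.1 + k * q.2 ≤ M} :=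
      convex_halfSpace_le ⟨fun x y => by simp; ring, fun c x => by simp; ring⟩ M
    refine convexHull_min ?_ hconv hq
    have key : ∀ a b, (n * a) ^ 2 + (m * b) ^ 2 ≤ M ^ 2 → planarEllipse a b ⊆
        {q : ℝ × ℝ | n * q.1 + k * q.2 ≤ M} := by
      rintro a b h q ⟨u, v, huv, h1, h2⟩
      rw [mem_ofPred_eq, h1, h2, ← mul_assoc, ← mul_assoc]
      refine (mul_add_mul_le_sqrt huv).trans ?_
      rw [mul_pow k, hk, ← mul_pow]
      exact sqrt_le_iff.2 ⟨hM, h⟩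
    exact union_subset (key _ _ h₁) (key _ _ h₂)
  rcases abs_choice q.2 with h | h
  · rw [h]; exact aux m rfl
  · rw [h]; have := aux (-m) (by ring); linarith

/-- The ellipse inscribed in the square `|x| + |y| ≤ √2` that touches it at
`√2 (cos² μ, sin² μ)`. -/
def inscribed (μ : ℝ) : Set (ℝ × ℝ) := planarEllipse (√2 * cos μ) (√2 * sin μ)

theorem mk_mem_inscribed {μ u y : ℝ} (h : |y| ≤ √2 * sin μ * sin u) :
    (√2 * cos μ * cos u, y) ∈ inscribed μ := by
  obtain ⟨l, hl, rfl⟩ := exists_eq_mul_of_abs_le h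
  refine ⟨cos u, l * sin u, ?_, rfl, by simp only; ring⟩
  rw [mul_pow]
  nlinarith [sq_nonneg (sin u), sin_sq_add_cos_sq u]

/-- The tangent to the $\mu$-ellipse at eccentric angle $u$ has normal $(\sin\mu\cos u,\cos\mu\sin
u)$. The $\nu$-ellipse lies on the same side of it exactly when the product in `hle` is nonpositive;
at $u=\mu$ the tangent is the side of the square touching both ellipses. Under this condition the
tangent supports the hull. -/
theorem abs_le_of_mem_hull_inscribed {μ ν u y : ℝ} (hμ : 0 < cos μ) (hμ' : 0 ≤ sin μ)
    (hu : 0 < sin u) (hle : (cos ν ^ 2 - cos μ ^ 2) * (cos u ^ 2 - cos μ ^ 2) ≤ 0)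
    (h : (√2 * cos μ * cos u, y) ∈ convexHull ℝ (inscribed μ ∪ inscribed ν)) :
    |y| ≤ √2 * sin μ * sin u := by
  have h2 : √2 ^ 2 = 2 := by norm_num
  have e1 := sin_sq_add_cos_sq μ
  have e2 := sin_sq_add_cos_sq ν
  have e3 := sin_sq_add_cos_sq u
  have key := add_mul_abs_le_of_mem_convexHull (n := sin μ * cos u) (m := cos μ * sin u)
    (M := √2 * (sin μ * cos μ)) (by positivity) (by
      have : (sin μ * cos u * (√2 * cos μ)) ^ 2 + (cos μ * sin u * (√2 * sin μ)) ^ 2 =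
        (√2 * (sin μ * cos μ)) ^ 2 * (sin u ^ 2 + cos u ^ 2) := by ring
      rw [this, e3, mul_one]) (by
      have : (√2 * (sin μ * cos μ)) ^ 2 - ((sin μ * cos u * (√2 * cos ν)) ^ 2 +
          (cos μ * sin u * (√2 * sin ν)) ^ 2) =
          -2 * ((cos ν ^ 2 - cos μ ^ 2) * (cos u ^ 2 - cos μ ^ 2)) := by
        have f1 : sin μ ^ 2 = 1 - cos μ ^ 2 := by linarith
        have f2 : sin ν ^ 2 = 1 - cos ν ^ 2 := by linarith
        have f3 : sin u ^ 2 = 1 - cos u ^ 2 := by linarith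
        simp only [mul_pow, h2, f1, f2, f3]
        ring
      linarith) h
  simp only at key
  refine le_of_mul_le_mul_left ?_ (mul_pos hμ hu)
  have : √2 * (sin μ * cos μ) = √2 * (sin μ * cos μ) * (sin u ^ 2 + cos u ^ 2) := by
    rw [e3, mul_one]
  nlinarith

theorem volume_slice_eq {Q : Set (ℝ × ℝ)} {x Y : ℝ} (h : ∀ y, (x, y) ∈ Q ↔ |y| ≤ Y) :
    volume (Prod.mk x ⁻¹' Q) = ENNReal.ofReal (2 * Y) := by
  have : Prod.mk x ⁻¹' Q = Icc (-Y) Y := by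
    ext y
    rw [mem_preimage, h, mem_Icc, abs_le]
  rw [this, Real.volume_Icc]
  congr 1
  ring

/-- Between the two contact points the side of the square is a chord joining the ellipses. Scaling
the ordinates of both contact points by the same $l$ reaches every point of the vertical slice. -/
theorem mem_hull_inscribed_of_line {μ ν x y : ℝ} (hx : x ∈ Ioo (√2 * cos ν ^ 2) (√2 * cos μ ^ 2))
    (hy : |y| ≤ √2 - x) : (x, y) ∈ convexHull ℝ (inscribed μ ∪ inscribed ν) := by
  obtain ⟨l, hl, rfl⟩ := exists_eq_mul_of_abs_le hy
  have hd : 0 < √2 * cos μ ^ 2 - √2 * cos ν ^ 2 := by linarith [hx.1, hx.2]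
  have hmem : ∀ κ, (√2 * cos κ ^ 2, l * (√2 * sin κ ^ 2)) ∈ inscribed κ := fun κ =>
    ⟨cos κ, l * sin κ, by
      rw [mul_pow]
      nlinarith [sq_nonneg (sin κ), sin_sq_add_cos_sq κ], by simp only; ring, by simp only; ring⟩
  set t := (x - √2 * cos ν ^ 2) / (√2 * cos μ ^ 2 - √2 * cos ν ^ 2) with ht
  have ht0 : 0 ≤ t := div_nonneg (by linarith [hx.1]) hd.le
  have ht1 : t ≤ 1 := (div_le_one hd).2 (by linarith [hx.2])
  have hxt : x = t * (√2 * cos μ ^ 2) + (1 - t) * (√2 * cos ν ^ 2) := by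
    have : t * (√2 * cos μ ^ 2 - √2 * cos ν ^ 2) = x - √2 * cos ν ^ 2 :=
      div_mul_cancel₀ _ hd.ne'
    linear_combination -this
  have := (convex_convexHull ℝ (inscribed μ ∪ inscribed ν))
    (subset_convexHull ℝ _ (Or.inl (hmem μ))) (subset_convexHull ℝ _ (Or.inr (hmem ν)))
    ht0 (sub_nonneg.2 ht1) (by ring)
  convert this using 1
  have f1 : sin μ ^ 2 = 1 - cos μ ^ 2 := by linarith [sin_sq_add_cos_sq μ]
  have f2 : sin ν ^ 2 = 1 - cos ν ^ 2 := by linarith [sin_sq_add_cos_sq ν]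
  ext
  · simp [← hxt]
  · simp only [Prod.smul_mk, Prod.mk_add_mk, smul_eq_mul, f1, f2]
    rw [hxt]
    ring

/-- On the right half, the upper boundary is the $\nu$-arc up to its contact point
$x=\sqrt2\cos^2\nu$, then the side of the square up to $\sqrt2\cos^2\mu$, then the $\mu$-arc up to
$\sqrt2\cos\mu$. In eccentric angles the arcs are $(\nu,\pi/2)$ and $(0,\mu)$. -/
theorem volume_hull_inscribed {μ ν : ℝ} (hμ : 0 ≤ μ) (hμν : μ ≤ ν) (hν : ν ≤ π / 2) :
    volume (convexHull ℝ (inscribed μ ∪ inscribed ν)) =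
      ENNReal.ofReal (4 * (cos μ ^ 2 - cos ν ^ 2 + μ * (sin μ * cos μ)
        + (π / 2 - ν) * (sin ν * cos ν))) := by
  set Q := convexHull ℝ (inscribed μ ∪ inscribed ν) with hQ
  have hpi := pi_pos
  have h2 : √2 ^ 2 = 2 := by norm_num
  have hcμ : 0 ≤ cos μ := cos_nonneg_of_mem_Icc ⟨by linarith, by linarith⟩
  have hcν : 0 ≤ cos ν := cos_nonneg_of_mem_Icc ⟨by linarith, by linarith⟩
  have hsμ : 0 ≤ sin μ := sin_nonneg_of_nonneg_of_le_pi hμ (by linarith)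
  have hsν : 0 ≤ sin ν := sin_nonneg_of_nonneg_of_le_pi (by linarith) (by linarith)
  have hcle : ∀ {x y : ℝ}, 0 ≤ x → x ≤ y → y ≤ π / 2 → cos y ^ 2 ≤ cos x ^ 2 :=
    fun {x y} hx hxy hy => pow_le_pow_left₀
      (cos_nonneg_of_mem_Icc ⟨by linarith, by linarith⟩)
      (cos_le_cos_of_nonneg_of_le_pi hx (by linarith) hxy) 2
  have hc2 := hcle hμ hμν hν
  have hmeas : MeasurableSet Q := (isCompact_convexHull_union (isCompact_planarEllipse _ _)
    (isCompact_planarEllipse _ _) (convex_planarEllipse _ _) (convex_planarEllipse _ _)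
    (planarEllipse_nonempty _ _) (planarEllipse_nonempty _ _)).isClosed.measurableSet
  have hsymm : ∀ x y, (x, y) ∈ Q → (-x, y) ∈ Q := fun x y h => by
    have hlin : IsLinearMap ℝ fun q : ℝ × ℝ => (-q.1, q.2) :=
      ⟨fun p q => by ext <;> simp; ring, fun c q => by ext <;> simp⟩
    have hsub : Q ⊆ (fun q : ℝ × ℝ => (-q.1, q.2)) ⁻¹' Q := by
      refine convexHull_min (fun q hq => subset_convexHull ℝ _ ?_)
        ((convex_convexHull ℝ _).is_linear_preimage hlin)
      rcases hq with ⟨u, v, huv, h1, h2⟩ | ⟨u, v, huv, h1, h2⟩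
      · exact Or.inl ⟨-u, v, by simpa using huv, by simp only [h1]; ring, h2⟩
      · exact Or.inr ⟨-u, v, by simpa using huv, by simp only [h1]; ring, h2⟩
    exact hsub h
  have hR : ∀ q ∈ Q, q.1 ≤ √2 * cos μ := fun q hq => by
    have := add_mul_abs_le_of_mem_convexHull (n := 1) (m := 0) (M := √2 * cos μ) (by positivity)
      (by simp) (by simp only [mul_pow, h2]; linarith) hq
    simpa using this
  have hle1 : √2 * cos ν ^ 2 ≤ √2 * cos μ ^ 2 :=
    mul_le_mul_of_nonneg_left hc2 (sqrt_nonneg _)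
  have hle2 : √2 * cos μ ^ 2 ≤ √2 * cos μ := by
    refine mul_le_mul_of_nonneg_left ?_ (sqrt_nonneg _)
    nlinarith [cos_le_one μ]
  have hsin : ∀ u, 0 < u → u ≤ π / 2 → 0 < sin u := fun u h h' =>
    sin_pos_of_pos_of_lt_pi h (by linarith)
  have hI1 : ∫⁻ x in Ioo 0 (√2 * cos ν ^ 2), volume (Prod.mk x ⁻¹' Q) =
      ENNReal.ofReal (√2 * cos ν * (√2 * sin ν) * (sin ν * cos ν - sin (π / 2) * cos (π / 2)
        + π / 2 - ν)) := by
    rw [← setLIntegral_ellipse_arc (F := fun x => volume (Prod.mk x ⁻¹' Q)) (by positivity)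
      (by positivity) (by linarith : 0 ≤ ν) hν le_rfl]
    · rw [cos_pi_div_two, mul_zero, pow_two, mul_assoc]
    · intro ha u hu
      have hu' := hsin u (by linarith [hu.1]) hu.2.le
      have hcu := hcle (by linarith) hu.1.le hu.2.le
      refine volume_slice_eq fun y => ⟨fun h => ?_, fun h => ?_⟩
      · rw [hQ, union_comm] at h
        exact abs_le_of_mem_hull_inscribed (pos_of_mul_pos_right ha (sqrt_nonneg _)) hsν hu'
          (mul_nonpos_of_nonneg_of_nonpos (by linarith) (by linarith)) h
      · exact subset_convexHull ℝ _ (Or.inr (mk_mem_inscribed h))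
  have hI3 : ∫⁻ x in Ioo (√2 * cos μ ^ 2) (√2 * cos μ), volume (Prod.mk x ⁻¹' Q) =
      ENNReal.ofReal (√2 * cos μ * (√2 * sin μ) * (sin 0 * cos 0 - sin μ * cos μ
        + μ - 0)) := by
    rw [← setLIntegral_ellipse_arc (F := fun x => volume (Prod.mk x ⁻¹' Q)) (by positivity)
      (by positivity) le_rfl hμ (by linarith)]
    · rw [cos_zero, mul_one, pow_two, mul_assoc]
    · intro ha u hu
      have hu' := hsin u hu.1 (by linarith [hu.2])
      have hcu := hcle hu.1.le hu.2.le (by linarith)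
      refine volume_slice_eq fun y => ⟨fun h => ?_, fun h => ?_⟩
      · exact abs_le_of_mem_hull_inscribed (pos_of_mul_pos_right ha (sqrt_nonneg _)) hsμ hu'
          (mul_nonpos_of_nonpos_of_nonneg (by linarith) (by linarith)) h
      · exact subset_convexHull ℝ _ (Or.inl (mk_mem_inscribed h))
  have hI2 : ∫⁻ x in Ioo (√2 * cos ν ^ 2) (√2 * cos μ ^ 2), volume (Prod.mk x ⁻¹' Q) =
      ENNReal.ofReal ((√2 * cos μ ^ 2 - √2 * cos ν ^ 2)
        * (2 * √2 - √2 * cos ν ^ 2 - √2 * cos μ ^ 2)) := by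
    refine setLIntegral_line hle1 ?_ fun x hx => volume_slice_eq fun y => ⟨fun h => ?_, fun h => ?_⟩
    · nlinarith [cos_sq_le_one μ, sqrt_nonneg 2]
    · have := add_mul_abs_le_of_mem_convexHull (n := 1) (m := 1) (M := √2) (sqrt_nonneg _)
        (by simp only [mul_pow, h2]; nlinarith [sin_sq_add_cos_sq μ])
        (by simp only [mul_pow, h2]; nlinarith [sin_sq_add_cos_sq ν]) h
      simp only at this
      linarith
    · exact mem_hull_inscribed_of_line hx h
  have hn1 : 0 ≤ √2 * cos ν * (√2 * sin ν) * (sin ν * cos ν - sin (π / 2) * cos (π / 2)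
      + π / 2 - ν) := by
    refine mul_nonneg (by positivity) ?_
    rw [cos_pi_div_two, mul_zero]
    nlinarith
  have hn2 : 0 ≤ (√2 * cos μ ^ 2 - √2 * cos ν ^ 2)
      * (2 * √2 - √2 * cos ν ^ 2 - √2 * cos μ ^ 2) := by
    refine mul_nonneg (by linarith) ?_
    nlinarith [cos_sq_le_one μ, cos_sq_le_one ν, sqrt_nonneg 2]
  have hn3 : 0 ≤ √2 * cos μ * (√2 * sin μ) * (sin 0 * cos 0 - sin μ * cos μ + μ - 0) := by
    refine mul_nonneg (by positivity) ?_
    rw [sin_zero]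
    nlinarith [sin_le hμ, cos_le_one μ]
  rw [volume_eq_two_mul_lintegral_slice hmeas hsymm hR,
    setLIntegral_Ioo_add (b := √2 * cos μ ^ 2) (by positivity) hle2,
    setLIntegral_Ioo_add (b := √2 * cos ν ^ 2) (by positivity) hle1, hI1, hI2, hI3,
    ← ENNReal.ofReal_add hn1 hn2,
    ← ENNReal.ofReal_add (add_nonneg hn1 hn2) hn3, ← ENNReal.ofReal_ofNat 2,
    ← ENNReal.ofReal_mul two_pos.le]
  congr 1
  have f1 : sin μ ^ 2 = 1 - cos μ ^ 2 := by linarith [sin_sq_add_cos_sq μ]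
  have f2 : sin ν ^ 2 = 1 - cos ν ^ 2 := by linarith [sin_sq_add_cos_sq ν]
  rw [cos_pi_div_two, sin_zero]
  ring_nf
  simp only [h2, f1, f2]
  ring

/-! ### Qubit states, product states and the separable numerical range -/

theorem convex_states (n : Type*) [Fintype n] : Convex ℝ (states n) := by
  rintro ρ ⟨hρ, hρ'⟩ σ ⟨hσ, hσ'⟩ s t hs ht hst
  refine ⟨(hρ.smul hs).add (hσ.smul ht), ?_⟩
  rw [Matrix.trace_add, Matrix.trace_smul, Matrix.trace_smul, hρ', hσ']
  simp only [Complex.real_smul, mul_one]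
  exact_mod_cast hst

theorem convex_numRange {n : Type*} [Fintype n] {k : ℕ} {S : Set (Matrix n n ℂ)}
    (hS : Convex ℝ S) (A : Fin k → Matrix n n ℂ) : Convex ℝ (numRange S A) := by
  rintro p ⟨ρ, hρ, hp⟩ q ⟨σ, hσ, hq⟩ s t hs ht hst
  refine ⟨s • ρ + t • σ, hS hρ hσ hs ht hst, fun j => ?_⟩
  rw [Matrix.add_mul, Matrix.trace_add, Matrix.smul_mul, Matrix.smul_mul, Matrix.trace_smul,
    Matrix.trace_smul, ← hp, ← hq]
  simp

/-- The linear map taking the unit circle to the curve `w ↦ r (cos w, cos (w - θ))`. -/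
def curveMap (r θ : ℝ) : ℂ →ₗ[ℝ] EuclideanSpace ℝ (Fin 2) where
  toFun w := !₂[r * w.re, r * (cos θ * w.re + sin θ * w.im)]
  map_add' w z := by ext i; fin_cases i <;> simp <;> ring
  map_smul' c w := by ext i; fin_cases i <;> simp <;> ring

theorem curveMap_apply_zero (r θ : ℝ) (w : ℂ) : curveMap r θ w 0 = r * w.re := rfl

theorem curveMap_apply_one (r θ : ℝ) (w : ℂ) :
    curveMap r θ w 1 = r * (cos θ * w.re + sin θ * w.im) := rfl

theorem exists_sign_mul_eq_abs (c : ℝ) : ∃ ε : ℝ, ε ^ 2 = 1 ∧ |c| = c * ε := by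
  rcases abs_choice c with h | h
  · exact ⟨1, by norm_num, by rw [h, mul_one]⟩
  · exact ⟨-1, by norm_num, by rw [h]; ring⟩

theorem mem_closedBall_iff_sq {w : ℂ} :
    w ∈ Metric.closedBall (0 : ℂ) 1 ↔ w.re ^ 2 + w.im ^ 2 ≤ 1 := by
  rw [mem_closedBall_zero_iff, ← sq_le_one_iff₀ (norm_nonneg w), Complex.sq_norm,
    Complex.normSq_apply, ← pow_two, ← pow_two]

/-- At $w=e^{it}$ the coordinates along the diagonals are
$r\sqrt2\cos\frac\theta2\cos(t-\frac\theta2)$ and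
$-r\sqrt2\sin\frac\theta2\sin\bigl(\frac\theta2-t\bigr)$ up to the sign of the second, so a rotation
of the disc by $\theta/2$ diagonalizes the map. -/
theorem ellipse_eq_curveMap_image (r θ : ℝ) :
    ellipse (r * √2 * |cos (θ / 2)|) (r * √2 * |sin (θ / 2)|) =
      curveMap r θ '' Metric.closedBall 0 1 := by
  obtain ⟨ε, hε, hc⟩ := exists_sign_mul_eq_abs (cos (θ / 2))
  obtain ⟨δ, hδ, hs⟩ := exists_sign_mul_eq_abs (sin (θ / 2))
  have h2 : √2 ^ 2 = 2 := by norm_num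
  have h0 : √2 ≠ 0 := by positivity
  have e1 : cos θ = 2 * cos (θ / 2) ^ 2 - 1 := by rw [← cos_two_mul]; congr 1; ring
  have e2 : sin θ = 2 * sin (θ / 2) * cos (θ / 2) := by rw [← sin_two_mul]; congr 1; ring
  have e3 := sin_sq_add_cos_sq (θ / 2)
  rw [hc, hs]
  set c := cos (θ / 2)
  set s := sin (θ / 2)
  ext p
  constructor
  · rintro ⟨u, v, h, h1, h2'⟩
    rw [div_eq_iff h0] at h1 h2'
    -- The complex number $e^{i\theta/2}(\varepsilon u+i\delta v)$; the signs absorb the absolute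
    -- values in the semi-axes.
    refine ⟨⟨c * (ε * u) - s * (δ * v), s * (ε * u) + c * (δ * v)⟩, ?_, ?_⟩
    · rw [mem_closedBall_iff_sq]
      calc (c * (ε * u) - s * (δ * v)) ^ 2 + (s * (ε * u) + c * (δ * v)) ^ 2
          = (s ^ 2 + c ^ 2) * (ε ^ 2 * u ^ 2 + δ ^ 2 * v ^ 2) := by ring
        _ ≤ 1 := by rw [e3, hε, hδ]; linarith
    · ext i
      fin_cases i
      · change r * (c * (ε * u) - s * (δ * v)) = p 0
        have : p 0 = √2 ^ 2 * r * (c * (ε * u) - s * (δ * v)) / 2 := by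
          linear_combination (h1 - h2') / 2
        rw [this, h2]; ring
      · change r * (cos θ * (c * (ε * u) - s * (δ * v))
          + sin θ * (s * (ε * u) + c * (δ * v))) = p 1
        have : p 1 = √2 ^ 2 * r * (c * (ε * u) + s * (δ * v)) / 2 := by
          linear_combination (h1 + h2') / 2
        rw [this, h2, e1, e2]
        linear_combination (2 * r * c * ε * u) * e3
  · rintro ⟨w, hw, rfl⟩
    rw [mem_closedBall_iff_sq] at hw
    refine ⟨ε * (c * w.re + s * w.im), δ * (-s * w.re + c * w.im), ?_, ?_, ?_⟩
    · calc (ε * (c * w.re + s * w.im)) ^ 2 + (δ * (-s * w.re + c * w.im)) ^ 2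
          = ε ^ 2 * (c * w.re + s * w.im) ^ 2 + δ ^ 2 * (-s * w.re + c * w.im) ^ 2 := by ring
        _ = (s ^ 2 + c ^ 2) * (w.re ^ 2 + w.im ^ 2) := by rw [hε, hδ]; ring
        _ ≤ 1 := by rw [e3]; linarith
    · rw [curveMap_apply_zero, curveMap_apply_one, div_eq_iff h0, e1, e2]
      linear_combination (-r * ε ^ 2 * c * (c * w.re + s * w.im)) * h2
        - (2 * r * c * (c * w.re + s * w.im)) * hε
    · rw [curveMap_apply_zero, curveMap_apply_one, div_eq_iff h0, e1, e2]
      linear_combination (-r * δ ^ 2 * s * (-s * w.re + c * w.im)) * h2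
        - (2 * r * s * (-s * w.re + c * w.im)) * hδ + (2 * r * w.re) * e3

/-- Reduces the inclusion of an ellipse in a convex set to its boundary curve, which pure states
realize. -/
theorem ellipse_eq_convexHull (r θ : ℝ) :
    ellipse (r * √2 * |cos (θ / 2)|) (r * √2 * |sin (θ / 2)|) =
      convexHull ℝ (curveMap r θ '' Metric.sphere 0 1) := by
  rw [ellipse_eq_curveMap_image, ← convexHull_sphere_eq_closedBall (0 : ℂ) zero_le_one,
    LinearMap.image_convexHull]

theorem exists_angle_of_mem_sphere {w : ℂ} (hw : w ∈ Metric.sphere (0 : ℂ) 1) :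
    ∃ t : ℝ, w.re = cos t ∧ w.im = sin t := by
  rw [mem_sphere_zero_iff_norm] at hw
  have hw0 : w ≠ 0 := fun h => by simp [h] at hw
  exact ⟨w.arg, by rw [Complex.cos_arg hw0, hw, div_one], by rw [Complex.sin_arg, hw, div_one]⟩

theorem trace_mul_obs_zero (θA θB : ℝ) (ρ : Matrix (Fin 2 × Fin 2) (Fin 2 × Fin 2) ℂ) :
    (ρ * obs θA θB 0).trace =
      ρ (0, 0) (1, 1) + ρ (1, 1) (0, 0) + ρ (0, 1) (1, 0) + ρ (1, 0) (0, 1) := by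
  simp [obs, pauliX, Matrix.trace, Matrix.mul_apply, Fintype.sum_prod_type, Fin.sum_univ_two]
  ring

theorem trace_mul_obs_one (θA θB : ℝ) (ρ : Matrix (Fin 2 × Fin 2) (Fin 2 × Fin 2) ℂ) :
    (ρ * obs θA θB 1).trace =
      cos θA * cos θB *
        (ρ (0, 0) (1, 1) + ρ (1, 1) (0, 0) + ρ (0, 1) (1, 0) + ρ (1, 0) (0, 1)) +
      sin θA * sin θB *
        (ρ (0, 0) (0, 0) + ρ (1, 1) (1, 1) - ρ (0, 1) (0, 1) - ρ (1, 0) (1, 0)) +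
      cos θA * sin θB *
        (ρ (0, 0) (1, 0) + ρ (1, 0) (0, 0) - ρ (0, 1) (1, 1) - ρ (1, 1) (0, 1)) +
      sin θA * cos θB *
        (ρ (0, 0) (0, 1) + ρ (0, 1) (0, 0) - ρ (1, 0) (1, 1) - ρ (1, 1) (1, 0)) := by
  simp [obs, pauliX, pauliZ, pauliXZ, Matrix.trace, Matrix.mul_apply, Fintype.sum_prod_type,
    Fin.sum_univ_two]
  ring

/-- The components of the Bloch vector of a qubit state in the `XZ` plane. -/
theorem exists_bloch {σ : Matrix (Fin 2) (Fin 2) ℂ} (hσ : σ ∈ states (Fin 2)) :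
    ∃ x z : ℝ, x ^ 2 + z ^ 2 ≤ 1 ∧ (σ * pauliX).trace = x ∧
      ∀ θ, (σ * pauliXZ θ).trace = ((cos θ * x + sin θ * z : ℝ) : ℂ) := by
  obtain ⟨hpos, htr⟩ := hσ
  have h10 : σ 1 0 = star (σ 0 1) := (hpos.1.apply 1 0).symm
  have h00 : σ 0 0 = ((σ 0 0).re : ℂ) := (Complex.conj_eq_iff_re.1 (hpos.1.apply 0 0)).symm
  have h11 : σ 1 1 = ((σ 1 1).re : ℂ) := (Complex.conj_eq_iff_re.1 (hpos.1.apply 1 1)).symm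
  have hdet := (Complex.le_def.1 hpos.det_nonneg).1
  rw [Matrix.det_fin_two, h10, h00, h11] at hdet
  rw [Matrix.trace_fin_two, h00, h11] at htr
  have htr' : (σ 0 0).re + (σ 1 1).re = 1 := by exact_mod_cast htr
  simp at hdet
  refine ⟨2 * (σ 0 1).re, (σ 0 0).re - (σ 1 1).re, ?_, ?_, fun θ => ?_⟩
  · have : ((σ 0 0).re + (σ 1 1).re) ^ 2 = 1 := by rw [htr', one_pow]
    nlinarith [sq_nonneg (σ 0 1).im]
  · simp [pauliX, Matrix.trace, Matrix.mul_apply, Fin.sum_univ_two, h10]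
    rw [Complex.add_conj]
    push_cast; rfl
  · have hre : σ 0 1 + (starRingEnd ℂ) (σ 0 1) = ((2 * (σ 0 1).re : ℝ) : ℂ) :=
      Complex.add_conj _
    simp [pauliXZ, pauliX, pauliZ, Matrix.trace, Matrix.mul_apply, Fin.sum_univ_two, h10]
    push_cast at hre
    rw [← h00, ← h11]
    linear_combination (Complex.cos θ) * hre

/-- The pure qubit state with real amplitudes `cos γ`, `sin γ`. -/
def pureQubit (γ : ℝ) : Matrix (Fin 2) (Fin 2) ℂ :=
  !![(cos γ : ℂ) ^ 2, cos γ * sin γ; cos γ * sin γ, (sin γ : ℂ) ^ 2]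

theorem pureQubit_mem_states (γ : ℝ) : pureQubit γ ∈ states (Fin 2) := by
  constructor
  · have := Matrix.posSemidef_vecMulVec_self_star (![(cos γ : ℂ), (sin γ : ℂ)])
    convert this using 1
    ext i j
    fin_cases i <;> fin_cases j <;>
      simp [pureQubit, Matrix.vecMulVec_apply, ← Complex.cos_conj, ← Complex.sin_conj] <;> ring
  · rw [Matrix.trace_fin_two]
    simp [pureQubit]

theorem trace_pureQubit_mul_pauliX (γ : ℝ) :
    (pureQubit γ * pauliX).trace = ((sin (2 * γ) : ℝ) : ℂ) := by
  rw [sin_two_mul]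
  simp [pureQubit, pauliX, Matrix.trace, Fin.sum_univ_two]
  ring

theorem trace_pureQubit_mul_pauliXZ (γ θ : ℝ) :
    (pureQubit γ * pauliXZ θ).trace = ((cos θ * sin (2 * γ) + sin θ * cos (2 * γ) : ℝ) : ℂ) := by
  rw [sin_two_mul, cos_two_mul']
  simp [pureQubit, pauliX, pauliZ, pauliXZ, Matrix.trace, Fin.sum_univ_two]
  ring

theorem trace_kronecker_mul_obs_zero (σ τ : Matrix (Fin 2) (Fin 2) ℂ) (θA θB : ℝ) :
    ((σ ⊗ₖ τ) * obs θA θB 0).trace = (σ * pauliX).trace * (τ * pauliX).trace := by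
  change ((σ ⊗ₖ τ) * (pauliX ⊗ₖ pauliX)).trace = _
  rw [← Matrix.mul_kronecker_mul, Matrix.trace_kronecker]

theorem trace_kronecker_mul_obs_one (σ τ : Matrix (Fin 2) (Fin 2) ℂ) (θA θB : ℝ) :
    ((σ ⊗ₖ τ) * obs θA θB 1).trace = (σ * pauliXZ θA).trace * (τ * pauliXZ θB).trace := by
  change ((σ ⊗ₖ τ) * (pauliXZ θA ⊗ₖ pauliXZ θB)).trace = _
  rw [← Matrix.mul_kronecker_mul, Matrix.trace_kronecker]

/-- The expectation values of the two observables, as a real linear map. -/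
def expectation (θA θB : ℝ) :
    Matrix (Fin 2 × Fin 2) (Fin 2 × Fin 2) ℂ →ₗ[ℝ] EuclideanSpace ℝ (Fin 2) where
  toFun ρ := !₂[(ρ * obs θA θB 0).trace.re, (ρ * obs θA θB 1).trace.re]
  map_add' ρ σ := by ext i; fin_cases i <;> simp [Matrix.add_mul]
  map_smul' c ρ := by ext i; fin_cases i <;> simp

theorem eq_expectation {θA θB : ℝ} {p : EuclideanSpace ℝ (Fin 2)}
    {ρ : Matrix (Fin 2 × Fin 2) (Fin 2 × Fin 2) ℂ}
    (hp : ∀ j, ((p j : ℝ) : ℂ) = (ρ * obs θA θB j).trace) : p = expectation θA θB ρ := by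
  ext i
  fin_cases i
  · exact congrArg Complex.re (hp 0)
  · exact congrArg Complex.re (hp 1)

theorem half_mul_sqrt_two_mul (x : ℝ) : 1 / 2 * √2 * x = x / √2 := by
  have h2 : √2 ^ 2 = 2 := by norm_num
  have h0 : √2 ≠ 0 := by positivity
  field_simp
  rw [h2]

theorem expectation_kronecker_mem {σ τ : Matrix (Fin 2) (Fin 2) ℂ} (hσ : σ ∈ states (Fin 2))
    (hτ : τ ∈ states (Fin 2)) (θA θB : ℝ) : expectation θA θB (σ ⊗ₖ τ) ∈
      curveMap (1 / 2) (θA - θB) '' Metric.closedBall 0 1 +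
      curveMap (1 / 2) (θA + θB) '' Metric.closedBall 0 1 := by
  obtain ⟨x, z, hxz, hX, hXZ⟩ := exists_bloch hσ
  obtain ⟨x', z', hxz', hX', hXZ'⟩ := exists_bloch hτ
  have hprod : (x ^ 2 + z ^ 2) * (x' ^ 2 + z' ^ 2) ≤ 1 :=
    mul_le_one₀ hxz (by positivity) hxz'
  -- With $v=x+iz$ and $v'=x'+iz'$ the two points are $v\bar v'$ and $vv'$.
  refine ⟨_, ⟨⟨x * x' + z * z', z * x' - x * z'⟩, ?_, rfl⟩,
    _, ⟨⟨x * x' - z * z', z * x' + x * z'⟩, ?_, rfl⟩, ?_⟩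
  · rw [mem_closedBall_iff_sq]; simp only; nlinarith
  · rw [mem_closedBall_iff_sq]; simp only; nlinarith
  · ext i
    fin_cases i
    · change 1 / 2 * (x * x' + z * z') + 1 / 2 * (x * x' - z * z') =
        ((σ ⊗ₖ τ) * obs θA θB 0).trace.re
      rw [trace_kronecker_mul_obs_zero, hX, hX', ← Complex.ofReal_mul, Complex.ofReal_re]
      ring
    · change 1 / 2 * (cos (θA - θB) * (x * x' + z * z') + sin (θA - θB) * (z * x' - x * z')) +
        1 / 2 * (cos (θA + θB) * (x * x' - z * z') + sin (θA + θB) * (z * x' + x * z')) =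
        ((σ ⊗ₖ τ) * obs θA θB 1).trace.re
      rw [trace_kronecker_mul_obs_one, hXZ, hXZ', ← Complex.ofReal_mul, Complex.ofReal_re,
        cos_sub, sin_sub, cos_add, sin_add]
      ring

theorem curve_add_curve_mem_LSEP (θA θB : ℝ) {v w : ℂ} (hv : v ∈ Metric.sphere (0 : ℂ) 1)
    (hw : w ∈ Metric.sphere (0 : ℂ) 1) :
    curveMap (1 / 2) (θA - θB) v + curveMap (1 / 2) (θA + θB) w ∈ LSEP θA θB := by
  obtain ⟨s, hs, hs'⟩ := exists_angle_of_mem_sphere hv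
  obtain ⟨t, ht, ht'⟩ := exists_angle_of_mem_sphere hw
  -- Bloch angles $a$, $b$ of the factors are chosen so that $a-b=s$ and $a+b=t$. Amplitude angle
  -- $\pi/4-a/2$ yields the Bloch vector $(\cos a,\sin a)$.
  obtain ⟨a, ha⟩ : ∃ a, a = (t + s) / 2 := ⟨_, rfl⟩
  obtain ⟨b, hb⟩ : ∃ b, b = (t - s) / 2 := ⟨_, rfl⟩
  have hsab : s = a - b := by rw [ha, hb]; ring
  have htab : t = a + b := by rw [ha, hb]; ring
  have hsin : ∀ x : ℝ, sin (2 * (π / 4 - x / 2)) = cos x := fun x => by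
    rw [← sin_pi_div_two_sub]; congr 1; ring
  have hcos : ∀ x : ℝ, cos (2 * (π / 4 - x / 2)) = sin x := fun x => by
    rw [← cos_pi_div_two_sub]; congr 1; ring
  refine ⟨pureQubit (π / 4 - a / 2) ⊗ₖ pureQubit (π / 4 - b / 2),
    subset_convexHull ℝ _ ⟨_, pureQubit_mem_states _, _, pureQubit_mem_states _, rfl⟩,
    fun j => ?_⟩
  fin_cases j
  · change ((1 / 2 * v.re + 1 / 2 * w.re : ℝ) : ℂ) = (_ * obs θA θB 0).trace
    rw [trace_kronecker_mul_obs_zero, trace_pureQubit_mul_pauliX, trace_pureQubit_mul_pauliX,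
      ← Complex.ofReal_mul, hsin, hsin, hs, ht, hsab, htab, cos_sub, cos_add]
    congr 1
    ring
  · change ((1 / 2 * (cos (θA - θB) * v.re + sin (θA - θB) * v.im)
      + 1 / 2 * (cos (θA + θB) * w.re + sin (θA + θB) * w.im) : ℝ) : ℂ) =
        (_ * obs θA θB 1).trace
    rw [trace_kronecker_mul_obs_one, trace_pureQubit_mul_pauliXZ, trace_pureQubit_mul_pauliXZ,
      ← Complex.ofReal_mul, hsin, hsin, hcos, hcos, hs, ht, hs', ht', hsab, htab,
      cos_sub, cos_add, cos_sub, cos_add, sin_sub, sin_add, sin_sub, sin_add]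
    congr 1
    ring

theorem LSEP_eq (θA θB : ℝ) : LSEP θA θB =
    ellipse (|cos ((θA - θB) / 2)| / √2) (|sin ((θA - θB) / 2)| / √2) +
    ellipse (|cos ((θA + θB) / 2)| / √2) (|sin ((θA + θB) / 2)| / √2) := by
  simp only [← half_mul_sqrt_two_mul]
  apply Subset.antisymm
  · rw [ellipse_eq_curveMap_image, ellipse_eq_curveMap_image]
    rintro p ⟨ρ, hρ, hp⟩
    rw [eq_expectation hp]
    have hconv : Convex ℝ (curveMap (1 / 2) (θA - θB) '' Metric.closedBall 0 1 +
        curveMap (1 / 2) (θA + θB) '' Metric.closedBall 0 1) :=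
      ((convex_closedBall _ _).linear_image _).add ((convex_closedBall _ _).linear_image _)
    refine convexHull_min ?_ (hconv.linear_preimage (expectation θA θB)) hρ
    rintro _ ⟨σ, hσ, τ, hτ, rfl⟩
    exact expectation_kronecker_mem hσ hτ θA θB
  · rw [ellipse_eq_convexHull, ellipse_eq_convexHull, ← convexHull_add]
    refine convexHull_min ?_ (convex_numRange (convex_convexHull ℝ _) _)
    rintro _ ⟨_, ⟨v, hv, rfl⟩, _, ⟨w, hw, rfl⟩, rfl⟩
    exact curve_add_curve_mem_LSEP θA θB hv hw

/-! ### The numerical range over all states -/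

theorem sq_le_mul_of_quadratic_nonneg {a b c : ℝ}
    (h : ∀ s t : ℝ, 0 ≤ a * s ^ 2 + 2 * c * (s * t) + b * t ^ 2) :
    0 ≤ a ∧ 0 ≤ b ∧ c ^ 2 ≤ a * b := by
  have ha : 0 ≤ a := by simpa using h 1 0
  have hb : 0 ≤ b := by simpa using h 0 1
  refine ⟨ha, hb, ?_⟩
  have := discrim_le_zero (a := a) (b := 2 * c) (c := b) (fun x => by
    have := h x 1
    nlinarith)
  rw [discrim] at this
  nlinarith

/-- A positive semidefinite real $2\times2$ matrix is its trace times a matrix with Bloch vector in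
the unit disc, because $(b-a)^2+4c^2\le(a+b)^2$. At trace zero all entries vanish and the zero
vector serves. -/
theorem smul_mem_of_sq_le {a b c : ℝ} (h : 0 ≤ a ∧ 0 ≤ b ∧ c ^ 2 ≤ a * b) :
    ∃ x z : ℝ, x ^ 2 + z ^ 2 ≤ 1 ∧ b - a = (a + b) * x ∧ 2 * c = (a + b) * z := by
  obtain ⟨ha, hb, hc⟩ := h
  rcases (add_nonneg ha hb).eq_or_lt with h0 | hpos
  · have ha0 : a = 0 := by linarith
    have hb0 : b = 0 := by linarith
    have hc0 : c = 0 := by rw [ha0, zero_mul] at hc; nlinarith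
    exact ⟨0, 0, by norm_num, by simp [ha0, hb0], by simp [hc0]⟩
  · refine ⟨(b - a) / (a + b), 2 * c / (a + b), ?_, by field_simp, by field_simp⟩
    rw [div_pow, div_pow, ← add_div, div_le_one (by positivity)]
    nlinarith

/-- The real part of $\rho$ is compressed to the two eigenspaces of $Y\otimes Y$, consisting over
the reals of $(s,t,t,-s)$ and $(s,t,-t,s)$. The observables do not connect the eigenspaces, so the
two compressions determine the expectations; their traces are the weights of the convex combination.
-/
theorem L_subset (θA θB : ℝ) : L θA θB ⊆ convexHull ℝ
    (curveMap 1 (θA - θB) '' Metric.closedBall 0 1 ∪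
     curveMap 1 (θA + θB) '' Metric.closedBall 0 1) := by
  rintro p ⟨ρ, ⟨hpos, htr⟩, hp⟩
  have hsymm : ∀ i j, (ρ i j).re = (ρ j i).re := fun i j => by
    rw [← hpos.1.apply i j]; simp
  have hquad := fun r : Fin 2 × Fin 2 → ℝ =>
    (Complex.le_def.1 (hpos.dotProduct_mulVec_nonneg (fun i => (r i : ℂ)))).1
  simp [dotProduct, Matrix.mulVec, Fintype.sum_prod_type, Fin.sum_univ_two] at hquad
  have htr' := congrArg Complex.re htr
  simp [Matrix.trace, Fintype.sum_prod_type, Fin.sum_univ_two] at htr'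
  have h0 := congrArg Complex.re (hp 0)
  have h1 := congrArg Complex.re (hp 1)
  rw [trace_mul_obs_zero] at h0
  rw [trace_mul_obs_one] at h1
  simp only [← Complex.ofReal_mul, Complex.add_re, Complex.sub_re, Complex.re_ofReal_mul,
    Complex.ofReal_re] at h0 h1
  rw [hsymm (1, 1) (0, 0), hsymm (1, 0) (0, 1)] at h0
  rw [hsymm (1, 1) (0, 0), hsymm (1, 0) (0, 1), hsymm (1, 0) (0, 0), hsymm (1, 1) (0, 1),
    hsymm (0, 1) (0, 0), hsymm (1, 1) (1, 0)] at h1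
  have hplus := sq_le_mul_of_quadratic_nonneg
    (a := ((ρ (0, 0) (0, 0)).re + (ρ (1, 1) (1, 1)).re - 2 * (ρ (0, 0) (1, 1)).re) / 2)
    (b := ((ρ (0, 1) (0, 1)).re + (ρ (1, 0) (1, 0)).re + 2 * (ρ (0, 1) (1, 0)).re) / 2)
    (c := ((ρ (0, 0) (0, 1)).re + (ρ (0, 0) (1, 0)).re - (ρ (0, 1) (1, 1)).re
      - (ρ (1, 0) (1, 1)).re) / 2) (fun s t => by
      have := hquad fun i => !![s, t; t, -s] i.1 i.2
      simp at this
      rw [hsymm (1, 1) (0, 0), hsymm (1, 0) (0, 1), hsymm (1, 0) (0, 0), hsymm (1, 1) (0, 1),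
        hsymm (0, 1) (0, 0), hsymm (1, 1) (1, 0)] at this
      nlinarith)
  have hminus := sq_le_mul_of_quadratic_nonneg
    (b := ((ρ (0, 0) (0, 0)).re + (ρ (1, 1) (1, 1)).re + 2 * (ρ (0, 0) (1, 1)).re) / 2)
    -- Here $a$ belongs to $t^2$ and $b$ to $s^2$: on $(s,t,-t,s)$ the observable $X\otimes X$ has
    -- the opposite sign pattern, so that $b-a$ is again its contribution.
    (a := ((ρ (0, 1) (0, 1)).re + (ρ (1, 0) (1, 0)).re - 2 * (ρ (0, 1) (1, 0)).re) / 2)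
    (c := ((ρ (0, 0) (0, 1)).re - (ρ (0, 0) (1, 0)).re + (ρ (0, 1) (1, 1)).re
      - (ρ (1, 0) (1, 1)).re) / 2) (fun t s => by
      have := hquad fun i => !![s, t; -t, s] i.1 i.2
      simp at this
      rw [hsymm (1, 1) (0, 0), hsymm (1, 0) (0, 1), hsymm (1, 0) (0, 0), hsymm (1, 1) (0, 1),
        hsymm (0, 1) (0, 0), hsymm (1, 1) (1, 0)] at this
      nlinarith)
  obtain ⟨x, z, hxz, hx, hz⟩ := smul_mem_of_sq_le hplus
  obtain ⟨x', z', hxz', hx', hz'⟩ := smul_mem_of_sq_le hminus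
  have hmem := (convex_convexHull ℝ (curveMap 1 (θA - θB) '' Metric.closedBall 0 1 ∪
      curveMap 1 (θA + θB) '' Metric.closedBall 0 1))
    (subset_convexHull ℝ _ (Or.inl ⟨⟨x', z'⟩, mem_closedBall_iff_sq.2 hxz', rfl⟩))
    (subset_convexHull ℝ _ (Or.inr ⟨⟨x, z⟩, mem_closedBall_iff_sq.2 hxz, rfl⟩))
    (add_nonneg hminus.1 hminus.2.1) (add_nonneg hplus.1 hplus.2.1) (by linarith)
  convert hmem using 1
  ext i
  fin_cases i
  · simp only [Fin.zero_eta, PiLp.add_apply, PiLp.smul_apply, smul_eq_mul, curveMap_apply_zero,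
      one_mul, ← hx, ← hx']
    linarith
  · simp only [Fin.mk_one, PiLp.add_apply, PiLp.smul_apply, smul_eq_mul, curveMap_apply_one,
      one_mul, mul_add, mul_left_comm _ (cos _), mul_left_comm _ (sin _), ← hx, ← hx', ← hz,
      ← hz']
    rw [h1, cos_sub, cos_add, sin_sub, sin_add]
    ring

/-- Points of the numerical range from the pure states with real amplitudes `(s, t, t', s') / √2`
in the computational basis. -/
theorem mem_L_of_amplitudes {θA θB s t s' t' : ℝ} (hst : s ^ 2 + t ^ 2 + t' ^ 2 + s' ^ 2 = 2)
    {p : EuclideanSpace ℝ (Fin 2)} (h0 : p 0 = s * s' + t * t')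
    (h1 : p 1 = cos θA * cos θB * (s * s' + t * t')
      + sin θA * sin θB * ((s ^ 2 + s' ^ 2 - t ^ 2 - t' ^ 2) / 2)
      + cos θA * sin θB * (s * t' - t * s') + sin θA * cos θB * (s * t - t' * s')) :
    p ∈ L θA θB := by
  have hr : (((√2)⁻¹ : ℝ) : ℂ) * (((√2)⁻¹ : ℝ) : ℂ) = 1 / 2 := by
    rw [← Complex.ofReal_mul, ← mul_inv, mul_self_sqrt two_pos.le]
    norm_num
  set r : ℂ := (((√2)⁻¹ : ℝ) : ℂ) with hrdef
  have hrs : (starRingEnd ℂ) r = r := Complex.conj_ofReal _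
  set ψ : Fin 2 × Fin 2 → ℂ := fun i => r * ((!![s, t; t', s'] i.1 i.2 : ℝ) : ℂ) with hψ
  have hentry : ∀ i j, Matrix.vecMulVec ψ (star ψ) i j =
      1 / 2 * ((!![s, t; t', s'] i.1 i.2 * !![s, t; t', s'] j.1 j.2 : ℝ) : ℂ) := fun i j => by
    rw [Matrix.vecMulVec_apply, Pi.star_apply, ← hr]
    simp only [hψ, Complex.star_def, map_mul, hrs, Complex.conj_ofReal, Complex.ofReal_mul]
    ring
  refine ⟨Matrix.vecMulVec ψ (star ψ), ⟨Matrix.posSemidef_vecMulVec_self_star ψ, ?_⟩, fun j => ?_⟩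
  · simp only [Matrix.trace, Matrix.diag_apply, Fintype.sum_prod_type, Fin.sum_univ_two, hentry]
    simp only [Matrix.of_apply, Matrix.cons_val', Matrix.cons_val_zero, Matrix.cons_val_one,
      Matrix.cons_val_fin_one]
    have := congrArg (fun x : ℝ => (x : ℂ)) hst
    push_cast at this ⊢
    linear_combination this / 2
  · fin_cases j
    · change ((p 0 : ℝ) : ℂ) = (_ * obs θA θB 0).trace
      rw [trace_mul_obs_zero, h0]
      simp only [hentry, Matrix.of_apply, Matrix.cons_val', Matrix.cons_val_zero,
        Matrix.cons_val_one, Matrix.cons_val_fin_one]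
      push_cast
      ring
    · change ((p 1 : ℝ) : ℂ) = (_ * obs θA θB 1).trace
      rw [trace_mul_obs_one, h1]
      simp only [hentry, Matrix.of_apply, Matrix.cons_val', Matrix.cons_val_zero,
        Matrix.cons_val_one, Matrix.cons_val_fin_one]
      push_cast
      ring

theorem L_eq_convexHull (θA θB : ℝ) : L θA θB = convexHull ℝ
    (ellipse (1 * √2 * |cos ((θA - θB) / 2)|) (1 * √2 * |sin ((θA - θB) / 2)|) ∪
     ellipse (1 * √2 * |cos ((θA + θB) / 2)|) (1 * √2 * |sin ((θA + θB) / 2)|)) := by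
  apply Subset.antisymm
  · rw [ellipse_eq_curveMap_image, ellipse_eq_curveMap_image]
    exact L_subset θA θB
  · have hconv : Convex ℝ (L θA θB) := convex_numRange (convex_states _) _
    refine convexHull_min (union_subset ?_ ?_) hconv
    all_goals
      rw [ellipse_eq_convexHull]
      refine convexHull_min ?_ hconv
      rintro _ ⟨w, hw, rfl⟩
      obtain ⟨t, ht, ht'⟩ := exists_angle_of_mem_sphere hw
      obtain ⟨u, rfl⟩ : ∃ u, t = 2 * u := ⟨t / 2, by ring⟩
      rw [cos_two_mul'] at ht
      rw [sin_two_mul] at ht'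
      have hu := sin_sq_add_cos_sq u
    -- Real vectors in the eigenspace $(s,t,-t,s)$ give the $\theta_-$ curve, those in $(s,t,t,-s)$
    -- the $\theta_+$ curve; the curve parameter is twice the amplitude angle.
    · refine mem_L_of_amplitudes (s := cos u) (t := sin u) (t' := -sin u) (s' := cos u)
        (by linarith) ?_ ?_
      · rw [curveMap_apply_zero, ht]; ring
      · rw [curveMap_apply_one, ht, ht', cos_sub, sin_sub]; ring
    · refine mem_L_of_amplitudes (s := sin u) (t := cos u) (t' := cos u) (s' := -sin u)
        (by linarith) ?_ ?_
      · rw [curveMap_apply_zero, ht]; ring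
      · rw [curveMap_apply_one, ht, ht', cos_add, sin_add]; ring

theorem sqrt_one_add_cos (θ : ℝ) : √(1 + cos θ) = √2 * |cos (θ / 2)| := by
  have : 1 + cos θ = 2 * cos (θ / 2) ^ 2 := by
    have := cos_two_mul (θ / 2)
    rw [mul_div_cancel₀ θ two_ne_zero] at this
    linarith
  rw [this, sqrt_mul two_pos.le, sqrt_sq_eq_abs]

theorem sqrt_one_sub_cos (θ : ℝ) : √(1 - cos θ) = √2 * |sin (θ / 2)| := by
  have : 1 - cos θ = 2 * sin (θ / 2) ^ 2 := by
    have := cos_two_mul (θ / 2)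
    rw [mul_div_cancel₀ θ two_ne_zero] at this
    linarith [sin_sq_add_cos_sq (θ / 2)]
  rw [this, sqrt_mul two_pos.le, sqrt_sq_eq_abs]

theorem L_eq (θA θB : ℝ) : L θA θB = convexHull ℝ
    (ellipse (√(1 + cos (θA - θB))) (√(1 - cos (θA - θB))) ∪
     ellipse (√(1 + cos (θA + θB))) (√(1 - cos (θA + θB)))) := by
  simp only [sqrt_one_add_cos, sqrt_one_sub_cos]
  simpa only [one_mul] using L_eq_convexHull θA θB

/-! ### Areas of the two numerical ranges -/

theorem volume_hull_ellipse {μ ν : ℝ} (hμ : 0 ≤ μ) (hμν : μ ≤ ν) (hν : ν ≤ π / 2) :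
    volume (convexHull ℝ (ellipse (√2 * cos μ) (√2 * sin μ) ∪ ellipse (√2 * cos ν) (√2 * sin ν))) =
      ENNReal.ofReal (4 * (cos μ ^ 2 - cos ν ^ 2 + μ * (sin μ * cos μ)
        + (π / 2 - ν) * (sin ν * cos ν))) := by
  have himage : convexHull ℝ (ellipse (√2 * cos μ) (√2 * sin μ) ∪
      ellipse (√2 * cos ν) (√2 * sin ν)) =
      rot.symm '' convexHull ℝ (inscribed μ ∪ inscribed ν) := by
    rw [ellipse_eq_image, ellipse_eq_image, ← image_union]
    exact (LinearMap.image_convexHull rot.symm.toLinearMap _).symm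
  rw [himage, volume_rot_symm_image, volume_hull_inscribed hμ hμν hν]
  exact (isCompact_convexHull_union (isCompact_planarEllipse _ _)
    (isCompact_planarEllipse _ _) (convex_planarEllipse _ _) (convex_planarEllipse _ _)
    (planarEllipse_nonempty _ _) (planarEllipse_nonempty _ _)).isClosed.measurableSet

theorem cos_sub_cos_add (θA θB : ℝ) : cos (θA - θB) - cos (θA + θB) = 2 * (sin θA * sin θB) := by
  rw [cos_sub, cos_add]; ring

theorem fullArea_nonneg {θA θB : ℝ} (hA : θA ∈ Icc 0 π) (hB : θB ∈ Icc 0 π) :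
    0 ≤ fullArea (θA - θB) (θA + θB) := by
  rw [fullArea, cos_sub_cos_add]
  have := sin_nonneg_of_mem_Icc hA
  have := sin_nonneg_of_mem_Icc hB
  positivity

theorem fullArea_pos {θA θB : ℝ} (hA : θA ∈ Icc 0 π) (hB : θB ∈ Icc 0 π)
    (h : ¬ (sin θA = 0 ∧ sin θB = 0)) : 0 < fullArea (θA - θB) (θA + θB) := by
  refine (fullArea_nonneg hA hB).lt_of_ne' fun h0 => h ?_
  rw [fullArea, cos_sub_cos_add] at h0
  have hsA := sin_nonneg_of_mem_Icc hA
  have hsB := sin_nonneg_of_mem_Icc hB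
  have h1 := abs_nonneg ((θA - θB) / 2 * sin (θA - θB))
  have h2 := abs_nonneg (((θA + θB) / 2 - π / 2) * sin (θA + θB))
  have h3 := mul_nonneg hsA hsB
  have e1 : sin θA * sin θB = 0 := by linarith
  have e2 : |(θA - θB) / 2 * sin (θA - θB)| = 0 := by linarith
  have e3 : (θA - θB) / 2 * sin (θA - θB) = 0 := abs_eq_zero.1 e2
  have key : sin (θA - θB) = 0 := by
    rcases mul_eq_zero.1 e3 with h | h
    · have : θA - θB = 0 := by linarith
      rw [this, sin_zero]
    · exact h
  rw [sin_sub] at key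
  rcases mul_eq_zero.1 e1 with h | h
  · refine ⟨h, ?_⟩
    rw [h, zero_mul, zero_sub, neg_eq_zero] at key
    refine (mul_eq_zero.1 key).resolve_left fun h' => ?_
    have := sin_sq_add_cos_sq θA
    rw [h, h'] at this
    norm_num at this
  · refine ⟨?_, h⟩
    rw [h, mul_zero, sub_zero] at key
    refine (mul_eq_zero.1 key).resolve_right fun h' => ?_
    have := sin_sq_add_cos_sq θB
    rw [h, h'] at this
    norm_num at this

theorem volume_L {θA θB : ℝ} (hA : θA ∈ Icc 0 π) (hB : θB ∈ Icc 0 π) :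
    volume (L θA θB) = ENNReal.ofReal (fullArea (θA - θB) (θA + θB)) := by
  have hpi := pi_pos
  obtain ⟨hA0, hA1⟩ := hA
  obtain ⟨hB0, hB1⟩ := hB
  -- The half-angles $\theta_\pm/2$ are folded into $[0,\pi/2]$, preserving $|\cos|$ and $|\sin|$.
  -- The order $\mu\le\nu$ expresses $|\theta_-|\le\min(\theta_+,2\pi-\theta_+)$, which holds on the
  -- parameter square.
  obtain ⟨μ, hμ⟩ : ∃ μ, μ = |(θA - θB) / 2| := ⟨_, rfl⟩
  obtain ⟨ν, hν⟩ : ∃ ν, ν = π / 2 - |(θA + θB) / 2 - π / 2| := ⟨_, rfl⟩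
  have hμ0 : 0 ≤ μ := hμ ▸ abs_nonneg _
  have hν1 : ν ≤ π / 2 := by rw [hν]; linarith [abs_nonneg ((θA + θB) / 2 - π / 2)]
  have hμν : μ ≤ ν := by
    rw [hμ, hν]
    rcases abs_cases ((θA - θB) / 2) with h | h <;>
      rcases abs_cases ((θA + θB) / 2 - π / 2) with h' | h' <;> linarith
  have hcμ : 0 ≤ cos μ := cos_nonneg_of_mem_Icc ⟨by linarith, by linarith⟩
  have hcν : 0 ≤ cos ν := cos_nonneg_of_mem_Icc ⟨by linarith, by linarith⟩
  have hsμ : 0 ≤ sin μ := sin_nonneg_of_nonneg_of_le_pi hμ0 (by linarith)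
  have hsν : 0 ≤ sin ν := sin_nonneg_of_nonneg_of_le_pi (by linarith) (by linarith)
  have e1 : |cos ((θA - θB) / 2)| = cos μ := by
    rw [← abs_of_nonneg hcμ, hμ, cos_abs]
  have e2 : |sin ((θA - θB) / 2)| = sin μ := by
    rw [← abs_of_nonneg hsμ, hμ]
    rcases abs_choice ((θA - θB) / 2) with h | h
    · rw [h]
    · rw [h, sin_neg, abs_neg]
  have e3 : |cos ((θA + θB) / 2)| = cos ν := by
    rw [← abs_of_nonneg hcν, hν, cos_pi_div_two_sub]
    rcases abs_choice ((θA + θB) / 2 - π / 2) with h | h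
    · rw [h, sin_sub_pi_div_two, abs_neg]
    · rw [h, sin_neg, sin_sub_pi_div_two, neg_neg]
  have e4 : |sin ((θA + θB) / 2)| = sin ν := by
    rw [← abs_of_nonneg hsν, hν, sin_pi_div_two_sub, cos_abs, cos_sub_pi_div_two]
  rw [L_eq_convexHull, one_mul, e1, e2, e3, e4, volume_hull_ellipse hμ0 hμν hν1, fullArea]
  congr 1
  have f1 : cos (θA - θB) = 2 * cos μ ^ 2 - 1 := by
    rw [← e1, sq_abs, ← cos_two_mul]; congr 1; ring
  have f2 : cos (θA + θB) = 2 * cos ν ^ 2 - 1 := by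
    rw [← e3, sq_abs, ← cos_two_mul]; congr 1; ring
  have f3 : |sin (θA - θB)| = 2 * (sin μ * cos μ) := by
    rw [← e1, ← e2, ← abs_mul, ← abs_two, ← abs_mul, ← mul_assoc, abs_two, ← sin_two_mul]
    congr 2; ring
  have f4 : |sin (θA + θB)| = 2 * (sin ν * cos ν) := by
    rw [← e3, ← e4, ← abs_mul, ← abs_two, ← abs_mul, ← mul_assoc, abs_two, ← sin_two_mul]
    congr 2; ring
  have f5 : |(θA + θB) / 2 - π / 2| = π / 2 - ν := by linarith
  rw [abs_mul, abs_mul, f1, f2, f3, f4, f5, ← hμ]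
  ring

theorem vol_L {θA θB : ℝ} (hA : θA ∈ Icc 0 π) (hB : θB ∈ Icc 0 π) :
    vol (L θA θB) = fullArea (θA - θB) (θA + θB) := by
  rw [vol, volume_L hA hB, ENNReal.toReal_ofReal (fullArea_nonneg hA hB)]

theorem volume_LSEP (θA θB : ℝ) : volume (LSEP θA θB) = ENNReal.ofReal
    (sumArea (|cos ((θA - θB) / 2)| / √2) (|sin ((θA - θB) / 2)| / √2)
      (|cos ((θA + θB) / 2)| / √2) (|sin ((θA + θB) / 2)| / √2)) := by
  rw [LSEP_eq]
  exact volume_ellipse_add (by positivity) (by positivity) (by positivity) (by positivity)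

theorem vol_LSEP (θA θB : ℝ) : vol (LSEP θA θB) =
    sumArea (|cos ((θA - θB) / 2)| / √2) (|sin ((θA - θB) / 2)| / √2)
      (|cos ((θA + θB) / 2)| / √2) (|sin ((θA + θB) / 2)| / √2) := by
  rw [vol, volume_LSEP, ENNReal.toReal_ofReal]
  exact sumArea_nonneg (by positivity) (by positivity) (by positivity) (by positivity)

/-- The integral formula has no singular parameters, so this continuity yields the limit statements
for the singular closed form. -/
theorem continuous_vol_LSEP : Continuous fun t : ℝ × ℝ => vol (LSEP t.1 t.2) := by
  simp only [vol_LSEP]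
  exact continuous_sumArea.comp (f := fun t : ℝ × ℝ =>
    (|cos ((t.1 - t.2) / 2)| / √2, |sin ((t.1 - t.2) / 2)| / √2,
      |cos ((t.1 + t.2) / 2)| / √2, |sin ((t.1 + t.2) / 2)| / √2)) (by fun_prop)

/-! ### Complete elliptic integrals and the closed forms -/

theorem integral_zero_pi_div_two_reflect (f : ℝ → ℝ) :
    ∫ t in (0 : ℝ)..π / 2, f (π / 2 - t) = ∫ t in (0 : ℝ)..π / 2, f t := by
  rw [intervalIntegral.integral_comp_sub_left, sub_self, sub_zero]

/-- The reciprocal-modulus transformation at the level of integrands: $t\mapsto\pi/2-t$ exchanges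
the roles of the semi-axes $1$ and $k$, up to rescaling by $k$. -/
theorem sqrt_one_sub_reflect {k : ℝ} (hk : 0 < k) (t : ℝ) :
    √(1 - (1 - k⁻¹ ^ 2) * sin (π / 2 - t) ^ 2) = k⁻¹ * √(1 - (1 - k ^ 2) * sin t ^ 2) := by
  rw [sin_pi_div_two_sub]
  have : 1 - (1 - k⁻¹ ^ 2) * cos t ^ 2 = k⁻¹ ^ 2 * (1 - (1 - k ^ 2) * sin t ^ 2) := by
    rw [cos_sq']
    field_simp
    ring
  rw [this, sqrt_mul (by positivity), sqrt_sq (by positivity)]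

theorem ellE_one_sub_inv_sq {k : ℝ} (hk : 0 < k) :
    ellE (1 - k⁻¹ ^ 2) = k⁻¹ * ellE (1 - k ^ 2) := by
  rw [ellE, ellE, ← integral_zero_pi_div_two_reflect, ← intervalIntegral.integral_const_mul]
  simp only [sqrt_one_sub_reflect hk]

theorem ellK_one_sub_inv_sq {k : ℝ} (hk : 0 < k) :
    ellK (1 - k⁻¹ ^ 2) = k * ellK (1 - k ^ 2) := by
  rw [ellK, ellK, ← integral_zero_pi_div_two_reflect, ← intervalIntegral.integral_const_mul]
  simp only [sqrt_one_sub_reflect hk]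
  congr 1
  ext t
  rw [one_div, mul_inv, inv_inv, one_div]

theorem integral_ellipseSupport {A B : ℝ} (hA : 0 < A) :
    ∫ t in (0 : ℝ)..π / 2, ellipseSupport A B t = A * ellE (1 - (B / A) ^ 2) := by
  rw [ellE, ← intervalIntegral.integral_const_mul]
  congr 1
  ext t
  have : (A * cos t) ^ 2 + (B * sin t) ^ 2 = A ^ 2 * (1 - (1 - (B / A) ^ 2) * sin t ^ 2) := by
    rw [mul_pow, cos_sq']
    field_simp
    ring
  rw [ellipseSupport, this, sqrt_mul (by positivity), sqrt_sq hA.le]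

theorem vol_LSEP_of_regular {θA θB : ℝ} (h : (θA, θB) ∈ regular) :
    vol (LSEP θA θB) = sepArea (θA - θB) (θA + θB) := by
  obtain ⟨hA, hB, hne, hne'⟩ := h
  simp only at hA hB hne hne'
  have hpi := pi_pos
  obtain ⟨hA0, hA1⟩ := hA
  obtain ⟨hB0, hB1⟩ := hB
  have hc₁ : 0 < cos ((θA - θB) / 2) := cos_pos_of_mem_Ioo ⟨by linarith, by linarith⟩
  have hs₂ : 0 < sin ((θA + θB) / 2) := sin_pos_of_pos_of_lt_pi (by linarith) (by linarith)
  have hs₁ : sin ((θA - θB) / 2) ≠ 0 := fun h => hne (by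
    have := (sin_eq_zero_iff_of_lt_of_lt (by linarith) (by linarith)).1 h
    linarith)
  have hc₂ : cos ((θA + θB) / 2) ≠ 0 := fun h => hne' (by
    rw [← sin_pi_div_two_sub] at h
    have := (sin_eq_zero_iff_of_lt_of_lt (by linarith) (by linarith)).1 h
    linarith)
  -- This is $k<1$, so the denominator $k^{-1}-k$ is nonzero; the difference of the two sides is
  -- $(\cos\theta_--\cos\theta_+)/2=\sin\theta_A\sin\theta_B$.
  have hlt : |sin ((θA - θB) / 2)| ^ 2 * |cos ((θA + θB) / 2)| ^ 2 <
      |cos ((θA - θB) / 2)| ^ 2 * |sin ((θA + θB) / 2)| ^ 2 := by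
    simp only [sq_abs]
    have h1 := cos_sub_cos_add θA θB
    have h2 := mul_pos (sin_pos_of_pos_of_lt_pi hA0 hA1) (sin_pos_of_pos_of_lt_pi hB0 hB1)
    have h3 := cos_two_mul ((θA - θB) / 2)
    have h4 := cos_two_mul ((θA + θB) / 2)
    rw [mul_div_cancel₀ _ two_ne_zero] at h3 h4
    rw [sin_sq, sin_sq]
    nlinarith
  have f3 : |sin (θA - θB)| = 2 * (|sin ((θA - θB) / 2)| * |cos ((θA - θB) / 2)|) := by
    rw [← abs_mul, ← abs_two, ← abs_mul, ← mul_assoc, abs_two, ← sin_two_mul]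
    congr 2; ring
  have f4 : |sin (θA + θB)| = 2 * (|sin ((θA + θB) / 2)| * |cos ((θA + θB) / 2)|) := by
    rw [← abs_mul, ← abs_two, ← abs_mul, ← mul_assoc, abs_two, ← sin_two_mul]
    congr 2; ring
  have hT : T (θA - θB) (θA + θB) = |sin ((θA - θB) / 2)| * |cos ((θA + θB) / 2)| /
      (|cos ((θA - θB) / 2)| * |sin ((θA + θB) / 2)|) := by
    rw [T, tan_eq_sin_div_cos, tan_eq_sin_div_cos, abs_div, abs_div, abs_div, div_div_div_eq]
  have hT' : T (θA + θB) (θA - θB) = (T (θA - θB) (θA + θB))⁻¹ := by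
    rw [T, T, ← abs_inv, inv_div]
  rw [vol_LSEP, sepArea, F, F, hT', abs_mul, abs_mul, f3, f4]
  have p1 : 0 < |cos ((θA - θB) / 2)| := abs_pos.2 hc₁.ne'
  have p2 : 0 < |sin ((θA + θB) / 2)| := abs_pos.2 hs₂.ne'
  have p3 : 0 < |sin ((θA - θB) / 2)| := abs_pos.2 hs₁
  have p4 : 0 < |cos ((θA + θB) / 2)| := abs_pos.2 hc₂
  set k := T (θA - θB) (θA + θB)
  set c₁ := |cos ((θA - θB) / 2)|
  set s₁ := |sin ((θA - θB) / 2)|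
  set c₂ := |cos ((θA + θB) / 2)|
  set s₂ := |sin ((θA + θB) / 2)|
  have hk : 0 < k := by rw [hT]; positivity
  have hkA : s₁ * c₂ = k * (c₁ * s₂) := by rw [hT]; field_simp
  have hk1 : k ^ 2 < 1 := by
    rw [hT, div_pow, div_lt_one (by positivity), mul_pow, mul_pow]
    exact hlt
  have h2 : √2 * √2 = 2 := by norm_num
  have hA2 : c₁ / √2 * (s₂ / √2) = c₁ * s₂ / 2 := by rw [div_mul_div_comm, h2]
  have hB2 : s₁ / √2 * (c₂ / √2) = s₁ * c₂ / 2 := by rw [div_mul_div_comm, h2]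
  rw [sumArea, hA2, hB2, integral_ellipseSupport (by positivity), ellE_one_sub_inv_sq hk,
    ellK_one_sub_inv_sq hk]
  have hratio : s₁ * c₂ / 2 / (c₁ * s₂ / 2) = k := by rw [hT]; field_simp
  rw [hratio, div_mul_div_comm, div_mul_div_comm, h2]
  -- Since $s_1c_2=k\,c_1s_2$, the $K$ terms cancel and the $E$ terms combine to
  -- $c_1s_2(k^{-1}-k)E(1-k^2)$.
  have hquot : 2 * (s₁ * c₂ * (ellK (1 - k ^ 2) - ellE (1 - k ^ 2)) -
      s₂ * c₁ * (k * ellK (1 - k ^ 2) - k⁻¹ * ellE (1 - k ^ 2))) / (k⁻¹ - k) =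
      2 * (c₁ * s₂) * ellE (1 - k ^ 2) := by
    have hd : 0 < k⁻¹ - k := by
      have : k⁻¹ - k = (1 - k ^ 2) / k := by field_simp
      rw [this]
      exact div_pos (by linarith) hk
    rw [div_eq_iff hd.ne', hkA]
    ring
  rw [hquot]
  ring

theorem ratio_eq (x y : ℝ) : ratio x y = sepArea x y / fullArea x y := by
  have hneg : T y x - T x y = -Ttilde x y := by rw [Ttilde]; ring
  have h : sepArea x y =
      2 * (π / 8 * (|sin x| + |sin y|) - Ftilde x y / Ttilde x y) := by
    rw [sepArea, hneg, div_neg, Ftilde]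
    ring
  rw [ratio, fullArea, h, mul_div_mul_left _ _ two_ne_zero, Gminus, Gplus]

theorem continuous_fullArea :
    Continuous fun t : ℝ × ℝ => fullArea (t.1 - t.2) (t.1 + t.2) := by
  unfold fullArea
  fun_prop

theorem tendsto_sepArea (θA θB : ℝ) :
    Filter.Tendsto (fun t : ℝ × ℝ => sepArea (t.1 - t.2) (t.1 + t.2))
      (nhdsWithin (θA, θB) regular) (nhds (vol (LSEP θA θB))) := by
  refine ((continuous_vol_LSEP.tendsto (θA, θB)).mono_left nhdsWithin_le_nhds).congr' ?_
  filter_upwards [self_mem_nhdsWithin] with t ht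
  exact vol_LSEP_of_regular ht

end TwoQubit

end

theorem theorem9 (θA θB : ℝ) (hA : θA ∈ Set.Icc 0 Real.pi) (hB : θB ∈ Set.Icc 0 Real.pi) :
    -- the separable numerical range is the Minkowski sum of two ellipses
    TwoQubit.LSEP θA θB =
      TwoQubit.ellipse (|Real.cos ((θA - θB) / 2)| / √2) (|Real.sin ((θA - θB) / 2)| / √2) +
      TwoQubit.ellipse (|Real.cos ((θA + θB) / 2)| / √2) (|Real.sin ((θA + θB) / 2)| / √2) ∧
    -- the numerical range is the convex hull of two other ellipses
    TwoQubit.L θA θB = convexHull ℝ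
      (TwoQubit.ellipse (√(1 + Real.cos (θA - θB))) (√(1 - Real.cos (θA - θB))) ∪
       TwoQubit.ellipse (√(1 + Real.cos (θA + θB))) (√(1 - Real.cos (θA + θB)))) ∧
    MeasureTheory.volume (TwoQubit.LSEP θA θB) ≠ ⊤ ∧
    MeasureTheory.volume (TwoQubit.L θA θB) ≠ ⊤ ∧
    -- the area of the numerical range
    TwoQubit.vol (TwoQubit.L θA θB) = TwoQubit.fullArea (θA - θB) (θA + θB) ∧
    -- the area of the separable numerical range and the volume ratio
    ((θA, θB) ∈ TwoQubit.regular →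
      TwoQubit.vol (TwoQubit.LSEP θA θB) = TwoQubit.sepArea (θA - θB) (θA + θB) ∧
      TwoQubit.vol (TwoQubit.LSEP θA θB) / TwoQubit.vol (TwoQubit.L θA θB) =
        TwoQubit.ratio (θA - θB) (θA + θB)) ∧
    -- at the remaining parameters the closed forms hold in the limit
    Filter.Tendsto (fun t : ℝ × ℝ => TwoQubit.sepArea (t.1 - t.2) (t.1 + t.2))
      (nhdsWithin (θA, θB) TwoQubit.regular)
      (nhds (TwoQubit.vol (TwoQubit.LSEP θA θB))) ∧
    (¬ (Real.sin θA = 0 ∧ Real.sin θB = 0) →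
      0 < TwoQubit.vol (TwoQubit.L θA θB) ∧
      Filter.Tendsto (fun t : ℝ × ℝ => TwoQubit.ratio (t.1 - t.2) (t.1 + t.2))
        (nhdsWithin (θA, θB) TwoQubit.regular)
        (nhds (TwoQubit.vol (TwoQubit.LSEP θA θB) / TwoQubit.vol (TwoQubit.L θA θB)))) := by
  open TwoQubit in
  refine ⟨LSEP_eq θA θB, L_eq θA θB, ?_, ?_, vol_L hA hB, fun h => ⟨vol_LSEP_of_regular h, ?_⟩,
    tendsto_sepArea θA θB, fun h => ⟨?_, ?_⟩⟩
  · rw [volume_LSEP]; exact ENNReal.ofReal_ne_top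
  · rw [volume_L hA hB]; exact ENNReal.ofReal_ne_top
  · rw [vol_LSEP_of_regular h, vol_L hA hB, ratio_eq]
  · rw [vol_L hA hB]; exact fullArea_pos hA hB h
  · simp only [ratio_eq]
    rw [vol_L hA hB]
    exact (tendsto_sepArea θA θB).div
      ((continuous_fullArea.tendsto (θA, θB)).mono_left nhdsWithin_le_nhds)
      (fullArea_pos hA hB h).ne'
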